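/- Let $\theta\in\mathbb{R}^n$ be unknown, let $C\in\mathbb{R}$, and consider the system $y_k=\phi_k^\top\theta+d_k$, $k\ge 1$, observed only through the binary measurements $s_k=I_{\{y_k\le C\}}$. Assume: 1. The (deterministic) regressors $\phi_k\in\mathbb{R}^n$ satisfy $\sup_{k\ge1}\|\phi_k\|\le M<\infty$, and there are a positive integer $N\ge n$ and a $\delta>0$ such that $\frac1N\sum_{i=k}^{k+N-1}\phi_i\phi_i^\top\ge\delta I_n$ (in the positive semidefinite order) for all $k\ge1$. 2. The noise $\{d_k\}_{k\ge1}$ is a sequence of i.i.d. random variables with zero mean and finite variance $\sigma^2$, with distribution function $F$ and density $f$; $F$ is Lipschitz continuous, and $\inf_{x\in X}f(x)>0$ for every nonempty bounded open set $X\subset\mathbb{R}$. For a constant $\beta>0$ and a deterministic initial value $\hat\theta_0\in\mathbb{R}^n$, let $$\hat\theta_k=\hat\theta_{k-1}+\frac{\beta\phi_k}{k}\left(F\left(C-\phi_k^\top\hat\theta_{k-1}\right)-s_k\right),\quad k\ge1,\qquad \tilde\theta_k=\hat\theta_k-\theta,$$ and put $$\eta=\beta\delta\underline f,\qquad \underline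 f=\lim_{z\to(M\|\theta\|)^+}\ \inf_{t\in[C-z,C+z]}f(t).$$ Then $\mathbb{E}\|\tilde\theta_k\|^2<\infty$ for every $k$ and, for any $\varepsilon>0$, as $k\to\infty$, $$\mathbb{E}\|\tilde\theta_k\|^2=\begin{cases}O\left(\frac1k\right),&\eta>\frac12;\\ O\left(\frac1{k^{2\eta-\varepsilon}}\right),&\eta\le\frac12.\end{cases}$$ If, moreover, $f$ is locally Lipschitz continuous, then $$\mathbb{E}\|\tilde\theta_k\|^2=\begin{cases}O\left(\frac1k\right),&\eta>\frac12;\\ O\left(\frac{\ln k}k\right),&\eta=\frac12;\\ O\left(\frac1{k^{2\eta}}\right),&\eta<\frac12.\end{cases}$$ -/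

import Mathlib

open MeasureTheory ProbabilityTheory Filter Topology Set
open scoped NNReal ENNReal

/-- The condition on the (deterministic) regressors `φ 1, φ 2, …`: they are bounded in norm by `M`,
and they are uniformly persistently exciting with window length `N ≥ n` and level `δ > 0`, i.e.
`(1/N) ∑_{i=k}^{k+N-1} φ i (φ i)ᵀ ≥ δ Iₙ` in the Loewner order for every `k ≥ 1`.
The value `φ 0` is irrelevant. -/
structure PersistentlyExciting {n : ℕ} (φ : ℕ → EuclideanSpace ℝ (Fin n))
    (M : ℝ) (N : ℕ) (δ : ℝ) : Prop where
  norm_le : ∀ k : ℕ, 1 ≤ k → ‖φ k‖ ≤ M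
  pos_window : 0 < N
  le_window : n ≤ N
  pos_level : 0 < δ
  excitation : ∀ k : ℕ, 1 ≤ k →
    (((1 / (N : ℝ)) • ∑ i ∈ Finset.Ico k (k + N), Matrix.vecMulVec (φ i).ofLp (φ i).ofLp)
      - δ • (1 : Matrix (Fin n) (Fin n) ℝ)).PosSemidef

/-- The condition on the noise `d 1, d 2, …`: i.i.d. real random variables with zero mean and finite
variance `σ ^ 2`, with distribution function `F` and density `f`; `F` is Lipschitz, and the infimum
of `f` over any (nonempty) bounded open set is positive (in particular `f > 0` everywhere).
The value `d 0` is irrelevant. -/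
structure AdmissibleNoise {Ω : Type*} [MeasurableSpace Ω] (P : Measure Ω)
    (d : ℕ → Ω → ℝ) (σ : ℝ) (F f : ℝ → ℝ) : Prop where
  measurable : ∀ k : ℕ, 1 ≤ k → Measurable (d k)
  indep : iIndepFun (fun k : ℕ => d (k + 1)) P
  distribution : ∀ k : ℕ, 1 ≤ k → ∀ x : ℝ, F x = P.real {ω | d k ω ≤ x}
  measurable_density : Measurable f
  density : ∀ k : ℕ, 1 ≤ k →
    P.map (d k) = (volume : Measure ℝ).withDensity (fun x => ENNReal.ofReal (f x))
  memLp_two : ∀ k : ℕ, 1 ≤ k → MemLp (d k) 2 P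
  mean_zero : ∀ k : ℕ, 1 ≤ k → ∫ ω, d k ω ∂P = 0
  variance_eq : ∀ k : ℕ, 1 ≤ k → variance (d k) P = σ ^ 2
  lipschitz : ∃ K : ℝ≥0, LipschitzWith K F
  density_inf_pos : ∀ X : Set ℝ, IsOpen X → Bornology.IsBounded X → X.Nonempty →
    0 < sInf (f '' X)

/-- The unobserved output `y_k = φ_kᵀ θ + d_k`. -/
noncomputable def output {n : ℕ} {Ω : Type*} (φ : ℕ → EuclideanSpace ℝ (Fin n))
    (θ : EuclideanSpace ℝ (Fin n)) (d : ℕ → Ω → ℝ) (k : ℕ) (ω : Ω) : ℝ :=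
  inner ℝ (φ k) θ + d k ω

open Classical in
/-- The binary observation `s_k = I_{y_k ≤ C}`. -/
noncomputable def binaryObs {n : ℕ} {Ω : Type*} (φ : ℕ → EuclideanSpace ℝ (Fin n))
    (θ : EuclideanSpace ℝ (Fin n)) (d : ℕ → Ω → ℝ) (C : ℝ) (k : ℕ) (ω : Ω) : ℝ :=
  if output φ θ d k ω ≤ C then 1 else 0

/-- The stochastic approximation algorithm with initial value `θ₀`:
`θ̂_k = θ̂_{k-1} + (β φ_k / k) (F (C - φ_kᵀ θ̂_{k-1}) - s_k)` for `k ≥ 1`,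
driven by a sequence of observations `s`. -/
noncomputable def saEstimate {n : ℕ} {Ω : Type*} (φ : ℕ → EuclideanSpace ℝ (Fin n))
    (F : ℝ → ℝ) (C β : ℝ) (s : ℕ → Ω → ℝ) (θ₀ : EuclideanSpace ℝ (Fin n)) :
    ℕ → Ω → EuclideanSpace ℝ (Fin n)
  | 0, _ => θ₀
  | k + 1, ω =>
      saEstimate φ F C β s θ₀ k ω +
        (β / ((k + 1 : ℕ) : ℝ) *
          (F (C - inner ℝ (φ (k + 1)) (saEstimate φ F C β s θ₀ k ω)) - s (k + 1) ω)) • φ (k + 1)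

/-- The estimation error `θ̃_k = θ̂_k - θ` of the algorithm run on the binary observations. -/
noncomputable def estError {n : ℕ} {Ω : Type*} (φ : ℕ → EuclideanSpace ℝ (Fin n))
    (θ : EuclideanSpace ℝ (Fin n)) (d : ℕ → Ω → ℝ) (F : ℝ → ℝ) (C β : ℝ)
    (θ₀ : EuclideanSpace ℝ (Fin n)) (k : ℕ) (ω : Ω) : EuclideanSpace ℝ (Fin n) :=
  saEstimate φ F C β (binaryObs φ θ d C) θ₀ k ω - θ

/-- The right limit, as `z ↓ r`, of the infimum of `f` over `[C - z, C + z]`. -/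
noncomputable def lowerDensity (f : ℝ → ℝ) (C r : ℝ) : ℝ :=
  limUnder (𝓝[>] r) (fun z : ℝ => sInf (f '' Icc (C - z) (C + z)))

/-- For a nonnegative function and `r ≥ 0` the right limit in `lowerDensity` exists. -/
theorem tendsto_lowerDensity (f : ℝ → ℝ) (hf : ∀ x, 0 ≤ f x) (C r : ℝ) (hr : 0 ≤ r) :
    Tendsto (fun z : ℝ => sInf (f '' Icc (C - z) (C + z))) (𝓝[>] r)
      (𝓝 (lowerDensity f C r)) := by
  refine tendsto_nhds_limUnder ?_
  have hanti : AntitoneOn (fun z : ℝ => sInf (f '' Icc (C - z) (C + z))) (Ioi r) := by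
    intro a ha b _ hab
    have ha' : r < a := ha
    refine csInf_le_csInf ⟨0, ?_⟩ ?_ ?_
    · rintro _ ⟨x, _, rfl⟩
      exact hf x
    · exact ⟨f C, C, ⟨by linarith, by linarith⟩, rfl⟩
    · exact image_mono (Icc_subset_Icc (by linarith) (by linarith))
  have hbdd : BddAbove ((fun z : ℝ => sInf (f '' Icc (C - z) (C + z))) '' Ioi r) := by
    refine ⟨f C, ?_⟩
    rintro _ ⟨z, hz, rfl⟩
    have hz' : r < z := hz
    refine csInf_le ⟨0, ?_⟩ ⟨C, ⟨by linarith, by linarith⟩, rfl⟩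
    rintro _ ⟨x, _, rfl⟩
    exact hf x
  exact ⟨_, hanti.tendsto_nhdsGT hbdd⟩

/-! The estimation error is a recursion with gain `β / k`, increments of norm at most `β * M / k`,
noise `F (C - φᵀθ) - s` that is centred given the past, and restoring force `g u = F a - F (a - u)`
with `a = C - φᵀθ`. The force has the sign of `u`, stays away from zero when `u` does, and near `u =
0` has slope at least about `lowerDensity f C (M * ‖θ‖)`, because `a` stays within `M * ‖θ‖` of `C`.
A single regressor controls only one direction, so every drift estimate is taken over a window of
`N` steps; the error moves only by `O(1/k)` inside it and can be frozen at the start of the window.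

The force is bounded, so the quadratic contraction holds only locally, and large errors must be
shown to be very improbable. The exponential moments of `l * smoothNorm x` serve this purpose: far
from the origin a window multiplies them by `1 - a * l / k` as long as `l ≤ c * k`. The error grows
at most logarithmically, so the contraction can be started at a time `m ≈ K ^ α` with `l ≈ c * m`;
for small `α` the decay accumulated up to `K` beats the initial size. Markov's inequality then gives
a tail `exp (-b * K ^ α)` up to a linear factor (`exists_tail_exp`), negligible against every power
of `K`.

Near the origin the Lyapunov function is `‖v‖² + B * ‖v‖³`. The cubic term absorbs a loss of slope
that is linear in `|u|`, so a locally Lipschitz density costs nothing in the exponent. This yields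
`e (k + N) ≤ (1 - p * N / k) * e k + c / k²` with `p = 2 * β * δ * f'`
(`exists_integral_lyapunov_recursion`). Comparison with `k ^ (-p)` plus a multiple of `1 / k`, or of
`log k / k` when `p = 1`, gives the rates. With a locally Lipschitz density `f'` is the limiting
density bound itself; otherwise it is any smaller value, which accounts for the `ε`. -/

/-- A stochastic approximation recursion
`x (k+1) = x k + (β / (k+1)) (ξ (k+1) - g (k+1) ⟪φ (k+1), x k⟫) φ (k+1)` with gains `β / (k+1)`,
bounded persistently exciting regressors, bounded increments, noise `ξ` orthogonal to the past,
and a restoring force `g`. -/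
structure StochasticRecursion {n : ℕ} {Ω : Type*} [mΩ : MeasurableSpace Ω] (P : Measure Ω)
    (φ : ℕ → EuclideanSpace ℝ (Fin n)) (M β δ : ℝ) (N : ℕ) (R₀ : ℝ) (g : ℕ → ℝ → ℝ)
    (ℱ : ℕ → MeasurableSpace Ω) (x : ℕ → Ω → EuclideanSpace ℝ (Fin n)) (ξ : ℕ → Ω → ℝ) :
    Prop where
  gain_pos : 0 < β
  level_pos : 0 < δ
  window_pos : 0 < N
  norm_regressor_le : ∀ k, ‖φ (k + 1)‖ ≤ M
  excitation : ∀ k (v : EuclideanSpace ℝ (Fin n)),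
    N * δ * ‖v‖ ^ 2 ≤ ∑ i ∈ Finset.range N, (inner ℝ (φ (k + i + 1)) v : ℝ) ^ 2
  filtration_le : ∀ k, ℱ k ≤ mΩ
  filtration_mono : Monotone ℱ
  adapted : ∀ k, Measurable[ℱ k] (x k)
  norm_init_le : ∀ ω, ‖x 0 ω‖ ≤ R₀
  recursion : ∀ k ω, x (k + 1) ω = x k ω +
    (β / ((k : ℝ) + 1) * (ξ (k + 1) ω - g (k + 1) (inner ℝ (φ (k + 1)) (x k ω)))) • φ (k + 1)
  abs_le_one : ∀ k ω, |ξ (k + 1) ω - g (k + 1) (inner ℝ (φ (k + 1)) (x k ω))| ≤ 1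
  noise_measurable : ∀ k, Measurable (ξ (k + 1))
  noise_bounded : ∀ k, ∃ c, ∀ ω, |ξ (k + 1) ω| ≤ c
  noise_orthogonal : ∀ k (G : Ω → ℝ), Measurable[ℱ k] G → (∃ c, ∀ ω, |G ω| ≤ c) →
    ∫ ω, G ω * ξ (k + 1) ω ∂P = 0
  force_continuous : ∀ k, Continuous (g (k + 1))
  force_nonneg : ∀ k u, 0 ≤ u * g (k + 1) u
  force_lower : ∀ r, 0 < r → ∃ c, 0 < c ∧ ∀ k u, r ≤ |u| → c * |u| ≤ u * g (k + 1) u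

/-! ### A priori growth and integrated Lyapunov inequalities -/

namespace StochasticRecursion

set_option linter.unusedSectionVars false

variable {n : ℕ} {Ω : Type*} [mΩ : MeasurableSpace Ω] {P : Measure Ω} [IsProbabilityMeasure P]
  {φ : ℕ → EuclideanSpace ℝ (Fin n)} {M β δ : ℝ} {N : ℕ} {R₀ : ℝ} {g : ℕ → ℝ → ℝ}
  {ℱ : ℕ → MeasurableSpace Ω} {x : ℕ → Ω → EuclideanSpace ℝ (Fin n)} {ξ : ℕ → Ω → ℝ}

theorem bound_nonneg (h : StochasticRecursion P φ M β δ N R₀ g ℱ x ξ) : 0 ≤ M :=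
  (norm_nonneg _).trans (h.norm_regressor_le 0)

theorem gain_mul_bound_nonneg (h : StochasticRecursion P φ M β δ N R₀ g ℱ x ξ) : 0 ≤ β * M :=
  mul_nonneg h.gain_pos.le h.bound_nonneg

theorem norm_increment_le (h : StochasticRecursion P φ M β δ N R₀ g ℱ x ξ) (k : ℕ) (ω : Ω) :
    ‖(β / ((k : ℝ) + 1) * (ξ (k + 1) ω - g (k + 1) (inner ℝ (φ (k + 1)) (x k ω)))) • φ (k + 1)‖
      ≤ β * M / (k + 1) := by
  have hk : (0 : ℝ) < k + 1 := by positivity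
  rw [norm_smul, Real.norm_eq_abs, abs_mul, abs_of_pos (div_pos h.gain_pos hk)]
  calc β / ((k : ℝ) + 1) * |ξ (k + 1) ω - g (k + 1) (inner ℝ (φ (k + 1)) (x k ω))| * ‖φ (k + 1)‖
      ≤ β / ((k : ℝ) + 1) * 1 * M := by
        have := h.gain_pos
        gcongr
        · exact h.abs_le_one k ω
        · exact h.norm_regressor_le k
    _ = β * M / (k + 1) := by ring

theorem norm_succ_sub_le (h : StochasticRecursion P φ M β δ N R₀ g ℱ x ξ) (k : ℕ) (ω : Ω) :
    ‖x (k + 1) ω - x k ω‖ ≤ β * M / (k + 1) := by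
  rw [h.recursion k ω, add_sub_cancel_left]
  exact h.norm_increment_le k ω

theorem norm_add_sub_le (h : StochasticRecursion P φ M β δ N R₀ g ℱ x ξ) (k i : ℕ) (ω : Ω) :
    ‖x (k + i) ω - x k ω‖ ≤ i * (β * M / (k + 1)) := by
  induction i with
  | zero => simp
  | succ i ih =>
    have h1 := h.norm_succ_sub_le (k + i) ω
    have h2 : β * M / (((k + i : ℕ) : ℝ) + 1) ≤ β * M / (k + 1) := by
      have := h.gain_mul_bound_nonneg
      push_cast
      gcongr
      linarith [Nat.cast_nonneg (α := ℝ) i]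
    calc ‖x (k + (i + 1)) ω - x k ω‖
        ≤ ‖x (k + i + 1) ω - x (k + i) ω‖ + ‖x (k + i) ω - x k ω‖ := by
          rw [← add_assoc]; exact norm_sub_le_norm_sub_add_norm_sub _ _ _
      _ ≤ β * M / (k + 1) + i * (β * M / (k + 1)) := by linarith
      _ = _ := by push_cast; ring

theorem norm_le_harmonic (h : StochasticRecursion P φ M β δ N R₀ g ℱ x ξ) (k : ℕ) (ω : Ω) :
    ‖x k ω‖ ≤ R₀ + β * M * harmonic k := by
  induction k with
  | zero => simpa using h.norm_init_le ω
  | succ k ih =>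
    have h1 := h.norm_succ_sub_le k ω
    have h2 : ‖x (k + 1) ω‖ ≤ ‖x (k + 1) ω - x k ω‖ + ‖x k ω‖ := by
      simpa using norm_add_le (x (k + 1) ω - x k ω) (x k ω)
    rw [harmonic_succ]
    push_cast
    rw [div_eq_mul_inv] at h1
    linarith

theorem norm_le_log (h : StochasticRecursion P φ M β δ N R₀ g ℱ x ξ) (k : ℕ) (ω : Ω) :
    ‖x k ω‖ ≤ R₀ + β * M * (1 + Real.log k) :=
  (h.norm_le_harmonic k ω).trans <| by
    have := h.gain_mul_bound_nonneg
    have := harmonic_le_one_add_log k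
    gcongr

theorem measurable (h : StochasticRecursion P φ M β δ N R₀ g ℱ x ξ) (k : ℕ) :
    Measurable (x k) :=
  (h.adapted k).mono (h.filtration_le k) le_rfl

theorem exists_bound (h : StochasticRecursion P φ M β δ N R₀ g ℱ x ξ) (k : ℕ)
    {G : EuclideanSpace ℝ (Fin n) → ℝ} (hG : Continuous G) : ∃ c, ∀ ω, |G (x k ω)| ≤ c := by
  obtain ⟨c, hc⟩ := (isCompact_closedBall (0 : EuclideanSpace ℝ (Fin n))
    (R₀ + β * M * harmonic k)).exists_bound_of_continuousOn hG.continuousOn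
  exact ⟨c, fun ω => hc _ (by simpa using h.norm_le_harmonic k ω)⟩

theorem integrable_comp (h : StochasticRecursion P φ M β δ N R₀ g ℱ x ξ) (k : ℕ)
    {G : EuclideanSpace ℝ (Fin n) → ℝ} (hG : Continuous G) :
    Integrable (fun ω => G (x k ω)) P := by
  obtain ⟨c, hc⟩ := h.exists_bound k hG
  exact Integrable.of_bound (hG.measurable.comp (h.measurable k)).aestronglyMeasurable c
    (Eventually.of_forall hc)

/-- The drift of the recursion at time `k`, at the point `v`. -/
noncomputable def _root_.recursionDrift (φ : ℕ → EuclideanSpace ℝ (Fin n)) (g : ℕ → ℝ → ℝ)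
    (k : ℕ) (v : EuclideanSpace ℝ (Fin n)) : ℝ :=
  inner ℝ (φ (k + 1)) v * g (k + 1) (inner ℝ (φ (k + 1)) v)

theorem continuous_drift (h : StochasticRecursion P φ M β δ N R₀ g ℱ x ξ) (k : ℕ) :
    Continuous (recursionDrift φ g k) := by
  have := h.force_continuous k
  unfold recursionDrift
  fun_prop

theorem drift_nonneg (h : StochasticRecursion P φ M β δ N R₀ g ℱ x ξ) (k : ℕ)
    (v : EuclideanSpace ℝ (Fin n)) : 0 ≤ recursionDrift φ g k v := h.force_nonneg k _

/-- The hypothesis `hstep` is a second-order upper expansion of `W` with gradient `q v • v`. The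
noise part of the linear term integrates to zero over any event of the past, leaving the drift and a
quadratic remainder. The restriction to `A` is needed because contraction holds only on events
decided at the start of a window. -/
theorem setIntegral_succ_le (h : StochasticRecursion P φ M β δ N R₀ g ℱ x ξ) (k : ℕ)
    {W q κ : EuclideanSpace ℝ (Fin n) → ℝ} (hW : Continuous W) (hq : Continuous q)
    (hκ : Continuous κ) (hκ0 : ∀ v, 0 ≤ κ v)
    (hstep : ∀ v w, ‖w‖ ≤ β * M / (k + 1) →
      W (v + w) ≤ W v + q v * inner ℝ v w + κ v * ‖w‖ ^ 2)
    {A : Set Ω} (hA : MeasurableSet[ℱ k] A) :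
    ∫ ω in A, W (x (k + 1) ω) ∂P ≤ ∫ ω in A, (W (x k ω)
      - β / (k + 1) * (q (x k ω) * recursionDrift φ g k (x k ω))
      + κ (x k ω) * (β * M / (k + 1)) ^ 2) ∂P := by
  have hA' : MeasurableSet A := h.filtration_le k _ hA
  set G : EuclideanSpace ℝ (Fin n) → ℝ := fun v => q v * inner ℝ (φ (k + 1)) v with hGdef
  have hG : Continuous G := by fun_prop
  have hξint : Integrable (fun ω => G (x k ω) * ξ (k + 1) ω) P := by
    obtain ⟨c, hc⟩ := h.noise_bounded k
    exact (h.integrable_comp k hG).mul_bdd (c := c)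
      (h.noise_measurable k).aestronglyMeasurable (Eventually.of_forall hc)
  have horth : ∫ ω in A, G (x k ω) * ξ (k + 1) ω ∂P = 0 := by
    rw [← integral_indicator hA']
    have : (A.indicator fun ω => G (x k ω) * ξ (k + 1) ω)
        = fun ω => (A.indicator (fun ω => G (x k ω)) ω) * ξ (k + 1) ω := by
      ext ω
      by_cases hω : ω ∈ A <;> simp [hω]
    rw [this]
    refine h.noise_orthogonal k _ ?_ ?_
    · exact (hG.measurable.comp (h.adapted k)).indicator hA
    · obtain ⟨c, hc⟩ := h.exists_bound k hG
      refine ⟨c, fun ω => ?_⟩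
      by_cases hω : ω ∈ A
      · simpa [hω] using hc ω
      · simpa [hω] using (abs_nonneg _).trans (hc ω)
  set B : EuclideanSpace ℝ (Fin n) → ℝ := fun v =>
    W v - β / (k + 1) * (q v * recursionDrift φ g k v) + κ v * (β * M / (k + 1)) ^ 2 with hBdef
  have hB : Continuous B := by
    have := h.continuous_drift k
    fun_prop
  have hpt : ∀ ω, W (x (k + 1) ω) ≤ B (x k ω) + β / (k + 1) * (G (x k ω) * ξ (k + 1) ω) := by
    intro ω
    have h1 := h.norm_increment_le k ω
    have h2 := hstep (x k ω) _ h1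
    rw [← h.recursion k ω, inner_smul_right, real_inner_comm (φ (k + 1)) (x k ω)] at h2
    have h3 := mul_le_mul_of_nonneg_left (pow_le_pow_left₀ (norm_nonneg _) h1 2) (hκ0 (x k ω))
    simp only [hBdef, hGdef, recursionDrift]
    linear_combination h2 + h3
  calc ∫ ω in A, W (x (k + 1) ω) ∂P
      ≤ ∫ ω in A, (B (x k ω) + β / (k + 1) * (G (x k ω) * ξ (k + 1) ω)) ∂P := by
        refine setIntegral_mono (h.integrable_comp (k + 1) hW).integrableOn ?_ hpt
        exact ((h.integrable_comp k hB).add (hξint.const_mul _)).integrableOn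
    _ = ∫ ω in A, B (x k ω) ∂P := by
        rw [integral_add (h.integrable_comp k hB).integrableOn (hξint.const_mul _).integrableOn,
          integral_const_mul, horth, mul_zero, add_zero]

theorem setIntegral_add_le (h : StochasticRecursion P φ M β δ N R₀ g ℱ x ξ) (k : ℕ)
    {W q κ : EuclideanSpace ℝ (Fin n) → ℝ} (hW : Continuous W) (hq : Continuous q)
    (hκ : Continuous κ) (hκ0 : ∀ v, 0 ≤ κ v)
    (hstep : ∀ v w, ‖w‖ ≤ β * M / (k + 1) →
      W (v + w) ≤ W v + q v * inner ℝ v w + κ v * ‖w‖ ^ 2)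
    {A : Set Ω} (hA : MeasurableSet[ℱ k] A) (i : ℕ) :
    ∫ ω in A, W (x (k + i) ω) ∂P ≤ ∫ ω in A, (W (x k ω) + ∑ j ∈ Finset.range i,
      (κ (x (k + j) ω) * (β * M / ((k + j : ℕ) + 1)) ^ 2
      - β / ((k + j : ℕ) + 1) * (q (x (k + j) ω) * recursionDrift φ g (k + j) (x (k + j) ω)))) ∂P
    := by
  have hcont : ∀ j, Continuous fun v => κ v * (β * M / ((k + j : ℕ) + 1)) ^ 2
      - β / ((k + j : ℕ) + 1) * (q v * recursionDrift φ g (k + j) v) := by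
    intro j
    have := h.continuous_drift (k + j)
    fun_prop
  have hsum : ∀ i, Integrable (fun ω => ∑ j ∈ Finset.range i,
      (κ (x (k + j) ω) * (β * M / ((k + j : ℕ) + 1)) ^ 2
      - β / ((k + j : ℕ) + 1) *
        (q (x (k + j) ω) * recursionDrift φ g (k + j) (x (k + j) ω)))) P := fun i =>
    integrable_finsetSum _ fun j _ => h.integrable_comp (k + j) (hcont j)
  induction i with
  | zero => simp
  | succ i ih =>
    have h1 := h.setIntegral_succ_le (k + i) hW hq hκ hκ0 (fun v w hw => hstep v w (hw.trans (by
      have := h.gain_mul_bound_nonneg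
      push_cast
      gcongr
      linarith [Nat.cast_nonneg (α := ℝ) i]))) (h.filtration_mono (Nat.le_add_right k i) _ hA)
    have e1 : ∀ ω, W (x (k + i) ω)
      - β / ((k + i : ℕ) + 1) * (q (x (k + i) ω) * recursionDrift φ g (k + i) (x (k + i) ω))
      + κ (x (k + i) ω) * (β * M / ((k + i : ℕ) + 1)) ^ 2
      = W (x (k + i) ω) + (κ (x (k + i) ω) * (β * M / ((k + i : ℕ) + 1)) ^ 2 -
        β / ((k + i : ℕ) + 1) * (q (x (k + i) ω) * recursionDrift φ g (k + i) (x (k + i) ω))) :=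
      fun ω => by ring
    simp_rw [e1] at h1
    rw [integral_add (h.integrable_comp _ hW).integrableOn
      (h.integrable_comp (k + i) (hcont i)).integrableOn] at h1
    simp_rw [Finset.sum_range_succ, ← add_assoc]
    have h2 := integral_add (μ := P.restrict A) ((h.integrable_comp k hW).add (hsum i)).integrableOn
      (h.integrable_comp (k + i) (hcont i)).integrableOn
    simp only [Pi.add_apply] at h2
    linarith

end StochasticRecursion

/-! ### The smoothed norm and its exponential -/

/-- The smoothed norm `√(1 + ‖v‖²)`. -/
noncomputable def smoothNorm {n : ℕ} (v : EuclideanSpace ℝ (Fin n)) : ℝ := √(1 + ‖v‖ ^ 2)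

section SmoothNorm

variable {n : ℕ} (v w : EuclideanSpace ℝ (Fin n))

theorem sq_smoothNorm : smoothNorm v ^ 2 = 1 + ‖v‖ ^ 2 := Real.sq_sqrt (by positivity)

theorem one_le_smoothNorm : 1 ≤ smoothNorm v :=
  Real.one_le_sqrt.2 (by nlinarith [sq_nonneg ‖v‖])

theorem smoothNorm_pos : 0 < smoothNorm v := one_pos.trans_le (one_le_smoothNorm v)

theorem norm_le_smoothNorm : ‖v‖ ≤ smoothNorm v := Real.le_sqrt_of_sq_le (by linarith)

theorem smoothNorm_le : smoothNorm v ≤ 1 + ‖v‖ :=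
  Real.sqrt_le_iff.2 ⟨by positivity, by nlinarith [norm_nonneg v]⟩

theorem continuous_smoothNorm : Continuous (smoothNorm (n := n)) := by
  unfold smoothNorm; fun_prop

theorem smoothNorm_add_le : smoothNorm (v + w) ≤ smoothNorm v + ‖w‖ := by
  refine Real.sqrt_le_iff.2 ⟨add_nonneg (smoothNorm_pos v).le (norm_nonneg w), ?_⟩
  have h1 : ‖v + w‖ ^ 2 ≤ (‖v‖ + ‖w‖) ^ 2 := pow_le_pow_left₀ (norm_nonneg _) (norm_add_le _ _) 2
  have h2 := mul_le_mul_of_nonneg_right (norm_le_smoothNorm v) (norm_nonneg w)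
  nlinarith [sq_smoothNorm v]

theorem smoothNorm_le_add (v w : EuclideanSpace ℝ (Fin n)) :
    smoothNorm v ≤ smoothNorm w + ‖v - w‖ := by
  simpa using smoothNorm_add_le w (v - w)

/-- From `2 * s * t ≤ s² + t²` with `s`, `t` the smoothed norms at `v + w` and `v`, divided by `2 *
t`; the bound `t ≥ 1` makes the curvature constant uniform, including at the origin. -/
theorem smoothNorm_add_le_inner :
    smoothNorm (v + w) ≤ smoothNorm v + inner ℝ v w / smoothNorm v + ‖w‖ ^ 2 / 2 := by
  have h0 := smoothNorm_pos v
  have h1 : smoothNorm (v + w) ^ 2 = smoothNorm v ^ 2 + 2 * inner ℝ v w + ‖w‖ ^ 2 := by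
    rw [sq_smoothNorm, sq_smoothNorm, norm_add_sq_real]; ring
  have h2 : ‖w‖ ^ 2 / (2 * smoothNorm v) ≤ ‖w‖ ^ 2 / 2 := by
    gcongr
    linarith [one_le_smoothNorm v]
  have h3 : smoothNorm (v + w)
      ≤ smoothNorm v + inner ℝ v w / smoothNorm v + ‖w‖ ^ 2 / (2 * smoothNorm v) := by
    have : smoothNorm v + inner ℝ v w / smoothNorm v + ‖w‖ ^ 2 / (2 * smoothNorm v)
        = (2 * smoothNorm v ^ 2 + 2 * inner ℝ v w + ‖w‖ ^ 2) / (2 * smoothNorm v) := by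
      field_simp
    rw [this, le_div_iff₀ (by positivity)]
    nlinarith [sq_nonneg (smoothNorm (v + w) - smoothNorm v)]
  linarith

/-- The exponential remainder contributes `(l * ‖w‖)²` and the curvature of `smoothNorm` contributes
`l * ‖w‖² / 2`, which is at most `l² * ‖w‖² / 2` since `l ≥ 1`; together they stay below `2 * l² *
‖w‖²`. -/
theorem exp_smoothNorm_add_le {l : ℝ} (hl : 1 ≤ l) (hw : l * ‖w‖ ≤ 1) :
    Real.exp (l * smoothNorm (v + w)) ≤ Real.exp (l * smoothNorm v)
      + (Real.exp (l * smoothNorm v) * (l / smoothNorm v)) * inner ℝ v w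
      + (2 * l ^ 2 * Real.exp (l * smoothNorm v)) * ‖w‖ ^ 2 := by
  set y := l * (smoothNorm (v + w) - smoothNorm v) with hy
  have hl0 : 0 ≤ l := by linarith
  have habs : |smoothNorm (v + w) - smoothNorm v| ≤ ‖w‖ := by
    rw [abs_le]
    have h1 := smoothNorm_add_le v w
    have h2 := smoothNorm_le_add v (v + w)
    have h3 : ‖v - (v + w)‖ = ‖w‖ := by rw [sub_add_cancel_left, norm_neg]
    constructor <;> linarith
  have hy1 : |y| ≤ l * ‖w‖ := by
    rw [hy, abs_mul, abs_of_nonneg hl0]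
    gcongr
  have hy2 : y ^ 2 ≤ (l * ‖w‖) ^ 2 := sq_le_sq' (abs_le.1 hy1).1 (abs_le.1 hy1).2
  have h1 := (abs_le.1 (Real.abs_exp_sub_one_sub_id_le (hy1.trans hw))).2
  have h2 := mul_le_mul_of_nonneg_left (smoothNorm_add_le_inner v w) hl0
  have h3 : l * ‖w‖ ^ 2 ≤ l ^ 2 * ‖w‖ ^ 2 := by
    gcongr
    nlinarith
  have h4 : Real.exp y ≤ 1 + l / smoothNorm v * inner ℝ v w + 2 * l ^ 2 * ‖w‖ ^ 2 := by
    have e : l * (inner ℝ v w / smoothNorm v) = l / smoothNorm v * inner ℝ v w := by ring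
    nlinarith [sq_nonneg (l * ‖w‖)]
  calc Real.exp (l * smoothNorm (v + w)) = Real.exp (l * smoothNorm v) * Real.exp y := by
        rw [← Real.exp_add]; congr 1; rw [hy]; ring
    _ ≤ Real.exp (l * smoothNorm v)
        * (1 + l / smoothNorm v * inner ℝ v w + 2 * l ^ 2 * ‖w‖ ^ 2) := by gcongr
    _ = _ := by ring

theorem continuous_exp_smoothNorm (l : ℝ) :
    Continuous fun v : EuclideanSpace ℝ (Fin n) => Real.exp (l * smoothNorm v) := by
  have := continuous_smoothNorm (n := n)
  fun_prop

end SmoothNorm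

/-! ### Contraction of exponential moments over an excitation window -/

namespace StochasticRecursion

set_option linter.unusedSectionVars false

variable {n : ℕ} {Ω : Type*} [mΩ : MeasurableSpace Ω] {P : Measure Ω} [IsProbabilityMeasure P]
  {φ : ℕ → EuclideanSpace ℝ (Fin n)} {M β δ : ℝ} {N : ℕ} {R₀ : ℝ} {g : ℕ → ℝ → ℝ}
  {ℱ : ℕ → MeasurableSpace Ω} {x : ℕ → Ω → EuclideanSpace ℝ (Fin n)} {ξ : ℕ → Ω → ℝ}

theorem measurableSet_le_norm (h : StochasticRecursion P φ M β δ N R₀ g ℱ x ξ) (r : ℝ) (k : ℕ) :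
    MeasurableSet[ℱ k] {ω | r ≤ ‖x k ω‖} :=
  h.adapted k (measurableSet_le measurable_const measurable_norm)

theorem exists_regressor (h : StochasticRecursion P φ M β δ N R₀ g ℱ x ξ) (k : ℕ)
    (v : EuclideanSpace ℝ (Fin n)) : ∃ j < N, √δ * ‖v‖ ≤ |inner ℝ (φ (k + j + 1)) v| := by
  have hN := h.window_pos
  by_contra! hcon
  have h1 : ∑ i ∈ Finset.range N, (inner ℝ (φ (k + i + 1)) v : ℝ) ^ 2
      < ∑ i ∈ Finset.range N, δ * ‖v‖ ^ 2 := by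
    refine Finset.sum_lt_sum_of_nonempty (Finset.nonempty_range_iff.2 hN.ne') fun i hi => ?_
    have h2 := hcon i (Finset.mem_range.1 hi)
    have h3 := pow_lt_pow_left₀ h2 (abs_nonneg _) two_ne_zero
    rwa [sq_abs, mul_pow, Real.sq_sqrt h.level_pos.le] at h3
  have h2 := h.excitation k v
  simp only [Finset.sum_const, Finset.card_range, nsmul_eq_mul] at h1
  linarith

theorem norm_window_le (h : StochasticRecursion P φ M β δ N R₀ g ℱ x ξ) (k : ℕ) {j : ℕ}
    (hj : j ≤ N) (ω : Ω) : ‖x (k + j) ω - x k ω‖ ≤ N * (β * M / (k + 1)) := by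
  refine (h.norm_add_sub_le k j ω).trans ?_
  have := h.gain_mul_bound_nonneg
  gcongr

theorem abs_inner_regressor_le (h : StochasticRecursion P φ M β δ N R₀ g ℱ x ξ) (k : ℕ)
    (v : EuclideanSpace ℝ (Fin n)) : |inner ℝ (φ (k + 1)) v| ≤ M * ‖v‖ :=
  (abs_real_inner_le_norm _ _).trans (by gcongr; exact h.norm_regressor_le k)

/-- Excitation provides one regressor of the window that sees `x k`. Moving from `x k` to `x (k +
j)` changes the inner product by `O(1/k)`, which eventually costs at most half of it, so the force
is still met outside a fixed neighbourhood of zero. -/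
theorem exists_drift_lower (h : StochasticRecursion P φ M β δ N R₀ g ℱ x ξ) {r : ℝ} (hr : 0 < r) :
    ∃ c, 0 < c ∧ ∀ᶠ k : ℕ in atTop, ∀ ω, r ≤ ‖x k ω‖ → ∃ j < N,
      c * ‖x k ω‖ ≤ recursionDrift φ g (k + j) (x (k + j) ω) := by
  have hδ : 0 < √δ := Real.sqrt_pos.2 h.level_pos
  have hM := h.bound_nonneg
  obtain ⟨c, hc, hcl⟩ := h.force_lower (√δ * r / 2) (by positivity)
  refine ⟨c * (√δ / 2), by positivity, ?_⟩
  have hlim : Tendsto (fun k : ℕ => M * (N * (β * M / ((k : ℝ) + 1)))) atTop (𝓝 0) := by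
    have h1 := (tendsto_one_div_add_atTop_nhds_zero_nat (𝕜 := ℝ)).const_mul (M * (N * (β * M)))
    rw [mul_zero] at h1
    refine h1.congr fun k => by ring
  filter_upwards [hlim.eventually_le_const (show 0 < √δ * r / 2 by positivity)] with k hk ω hω
  obtain ⟨j, hj, hjl⟩ := h.exists_regressor k (x k ω)
  refine ⟨j, hj, ?_⟩
  have h1 : |inner ℝ (φ (k + j + 1)) (x k ω)| ≤ |inner ℝ (φ (k + j + 1)) (x (k + j) ω)|
      + M * (N * (β * M / ((k : ℝ) + 1))) := by
    have e : inner ℝ (φ (k + j + 1)) (x k ω) = inner ℝ (φ (k + j + 1)) (x (k + j) ω)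
        - inner ℝ (φ (k + j + 1)) (x (k + j) ω - x k ω) := by
      rw [inner_sub_right]; ring
    rw [e]
    refine (abs_sub _ _).trans ?_
    gcongr
    refine (h.abs_inner_regressor_le (k + j) _).trans ?_
    gcongr
    exact h.norm_window_le k hj.le ω
  have h2 : √δ * r ≤ √δ * ‖x k ω‖ := by gcongr
  have h3 : √δ / 2 * ‖x k ω‖ ≤ |inner ℝ (φ (k + j + 1)) (x (k + j) ω)| := by linarith
  calc c * (√δ / 2) * ‖x k ω‖ = c * (√δ / 2 * ‖x k ω‖) := by ring
    _ ≤ c * |inner ℝ (φ (k + j + 1)) (x (k + j) ω)| := by gcongr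
    _ ≤ _ := hcl (k + j) _ (by linarith)

theorem exp_smoothNorm_window_le (h : StochasticRecursion P φ M β δ N R₀ g ℱ x ξ) {k : ℕ} {l : ℝ}
    (hl : 1 ≤ l) (hlk : l * (N * (β * M / (k + 1))) ≤ 1) {j : ℕ} (hj : j ≤ N) (ω : Ω) :
    Real.exp (l * smoothNorm (x (k + j) ω)) ≤ Real.exp 1 * Real.exp (l * smoothNorm (x k ω)) ∧
    Real.exp (l * smoothNorm (x k ω)) ≤ Real.exp 1 * Real.exp (l * smoothNorm (x (k + j) ω)) := by
  have hl0 : 0 ≤ l := by linarith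
  have h1 := h.norm_window_le k hj ω
  have h2 := smoothNorm_le_add (x (k + j) ω) (x k ω)
  have h3 := smoothNorm_le_add (x k ω) (x (k + j) ω)
  rw [norm_sub_rev] at h3
  rw [← Real.exp_add, ← Real.exp_add, Real.exp_le_exp, Real.exp_le_exp]
  constructor
  · nlinarith [mul_le_mul_of_nonneg_left (h2.trans (add_le_add_right h1 _)) hl0]
  · nlinarith [mul_le_mul_of_nonneg_left (h3.trans (add_le_add_right h1 _)) hl0]

/-- On `r ≤ ‖x k‖` the drift removes a fraction of order `l / k`, while the second-order error is of
order `(l / k)²`, hence smaller when `l / k` is small. On the complement the moment is bounded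
outright by the additive term. The constants do not depend on `l`, which is later chosen as a
function of the time. -/
theorem exists_exp_window_contraction (h : StochasticRecursion P φ M β δ N R₀ g ℱ x ξ) {r : ℝ}
    (hr : 0 < r) : ∃ a c : ℝ, 0 < a ∧ 0 < c ∧ ∀ᶠ k : ℕ in atTop, ∀ l : ℝ, 1 ≤ l → l ≤ c * (k + 1) →
      0 ≤ 1 - a * l / (k + 1) ∧
      ∫ ω, Real.exp (l * smoothNorm (x (k + N) ω)) ∂P ≤
        (1 - a * l / (k + 1)) * ∫ ω, Real.exp (l * smoothNorm (x k ω)) ∂P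
          + Real.exp 1 * Real.exp (l * √(1 + r ^ 2)) := by
  obtain ⟨c₀, hc₀, hdrift⟩ := h.exists_drift_lower hr
  have hN : (0 : ℝ) < N := by exact_mod_cast h.window_pos
  have hβ := h.gain_pos
  have hM := h.bound_nonneg
  set a₀ : ℝ := β * c₀ * (r / (2 + r)) / (Real.exp 1 * N) with ha₀
  have ha₀pos : 0 < a₀ := by positivity
  set b : ℝ := N * (2 * Real.exp 1 * (β * M) ^ 2) with hb
  have hb0 : 0 ≤ b := by positivity
  -- The three bounds on `l / (k + 1)` serve, in order, to keep the quadratic error below half of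
  -- the drift, to keep the exponential comparable within a window up to the factor `e`, and to keep
  -- the contraction factor nonnegative.
  set c : ℝ := min (min (a₀ / (2 * (b + 1))) (1 / (N * (β * M) + 1))) (1 / a₀) with hc
  have hc1 : c ≤ a₀ / (2 * (b + 1)) := (min_le_left _ _).trans (min_le_left _ _)
  have hc2 : c ≤ 1 / (N * (β * M) + 1) := (min_le_left _ _).trans (min_le_right _ _)
  have hc3 : c ≤ 1 / a₀ := min_le_right _ _
  have hcpos : 0 < c := by
    refine lt_min (lt_min ?_ ?_) ?_ <;> positivity
  refine ⟨a₀ / 2, c, by positivity, hcpos, ?_⟩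
  filter_upwards [hdrift] with k hk l hl hlc
  have hk1 : (0 : ℝ) < k + 1 := by positivity
  have hl0 : 0 < l := by linarith
  have hlk' : l / (k + 1) ≤ c := by rwa [div_le_iff₀ hk1]
  have hlk : l * (N * (β * M / (k + 1))) ≤ 1 := by
    have h1 : l / (k + 1) * (N * (β * M) + 1) ≤ 1 := by
      rw [← le_div_iff₀ (by positivity)]; exact hlk'.trans hc2
    have h2 : 0 ≤ l / (k + 1) := by positivity
    calc l * (N * (β * M / (k + 1))) = l / (k + 1) * (N * (β * M)) := by ring
      _ ≤ 1 := by linarith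
  have hfac : 0 ≤ 1 - a₀ / 2 * l / (k + 1) := by
    have h1 : l / (k + 1) * a₀ ≤ 1 := by
      rw [← le_div_iff₀ ha₀pos]; exact hlk'.trans hc3
    have h2 : a₀ / 2 * l / (k + 1) = l / (k + 1) * a₀ / 2 := by ring
    linarith
  refine ⟨hfac, ?_⟩
  set W : EuclideanSpace ℝ (Fin n) → ℝ := fun v => Real.exp (l * smoothNorm v) with hWdef
  have hW : Continuous W := continuous_exp_smoothNorm l
  set A : Set Ω := {ω | r ≤ ‖x k ω‖} with hAdef
  have hA : MeasurableSet[ℱ k] A := h.measurableSet_le_norm r k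
  have hA' : MeasurableSet A := h.filtration_le k _ hA
  have hpt : ∀ ω ∈ A, W (x k ω) + ∑ j ∈ Finset.range N,
      ((2 * l ^ 2 * W (x (k + j) ω)) * (β * M / ((k + j : ℕ) + 1)) ^ 2
      - β / ((k + j : ℕ) + 1) * ((W (x (k + j) ω) * (l / smoothNorm (x (k + j) ω)))
        * recursionDrift φ g (k + j) (x (k + j) ω)))
      ≤ (1 - a₀ / 2 * l / (k + 1)) * W (x k ω) := by
    intro ω hω
    have hW0 : 0 < W (x k ω) := Real.exp_pos _
    have hpos : ∀ j ∈ Finset.range N,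
        (2 * l ^ 2 * W (x (k + j) ω)) * (β * M / ((k + j : ℕ) + 1)) ^ 2
        ≤ 2 * l ^ 2 * (Real.exp 1 * W (x k ω)) * (β * M / (k + 1)) ^ 2 := by
      intro j hj
      have h1 := (h.exp_smoothNorm_window_le hl hlk (Finset.mem_range.1 hj).le ω).1
      have h2 := h.gain_mul_bound_nonneg
      have h3 : ((k : ℝ) + 1) ≤ (k + j : ℕ) + 1 := by push_cast; linarith [Nat.cast_nonneg (α := ℝ) j]
      gcongr
    have hneg : ∀ j, 0 ≤ β / ((k + j : ℕ) + 1) *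
        ((W (x (k + j) ω) * (l / smoothNorm (x (k + j) ω)))
        * recursionDrift φ g (k + j) (x (k + j) ω)) := by
      intro j
      have := h.drift_nonneg (k + j) (x (k + j) ω)
      have := smoothNorm_pos (x (k + j) ω)
      positivity
    obtain ⟨j, hj, hjd⟩ := hk ω hω
    -- Only the one excited index `j` is used; the drift at the other indices is nonnegative and is
    -- discarded.
    have hmain : a₀ * l / (k + 1) * W (x k ω) ≤ β / ((k + j : ℕ) + 1) *
        ((W (x (k + j) ω) * (l / smoothNorm (x (k + j) ω)))
        * recursionDrift φ g (k + j) (x (k + j) ω)) := by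
      have h1 := (h.exp_smoothNorm_window_le hl hlk hj.le ω).2
      have h2 : smoothNorm (x (k + j) ω) ≤ 2 + ‖x k ω‖ := by
        have i1 := smoothNorm_le_add (x (k + j) ω) (x k ω)
        have i2 := h.norm_window_le k hj.le ω
        have i3 := smoothNorm_le (x k ω)
        have i4 : N * (β * M / ((k : ℝ) + 1)) ≤ l * (N * (β * M / (k + 1))) :=
          le_mul_of_one_le_left (by have := h.gain_mul_bound_nonneg; positivity) hl
        linarith
      have h3 : W (x k ω) / Real.exp 1 ≤ W (x (k + j) ω) := by
        rw [div_le_iff₀ (Real.exp_pos 1), mul_comm]; exact h1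
      have h4 : β / (N * (k + 1)) ≤ β / ((k + j : ℕ) + 1) := by
        have i1 : ((j : ℝ) + 1) ≤ N := by exact_mod_cast hj
        have i2 : (1 : ℝ) ≤ N := by linarith [Nat.cast_nonneg (α := ℝ) j]
        gcongr
        push_cast
        nlinarith [Nat.cast_nonneg (α := ℝ) k]
      have h5 : l / (2 + ‖x k ω‖) ≤ l / smoothNorm (x (k + j) ω) := by
        have := smoothNorm_pos (x (k + j) ω)
        gcongr
      have h6 : r / (2 + r) ≤ ‖x k ω‖ / (2 + ‖x k ω‖) := by
        have : r ≤ ‖x k ω‖ := hω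
        rw [div_le_div_iff₀ (by positivity) (by positivity)]
        nlinarith
      calc a₀ * l / (k + 1) * W (x k ω)
          = β / (N * (k + 1)) * (W (x k ω) / Real.exp 1 * (l * (c₀ * (r / (2 + r))))) := by
            rw [ha₀]; field_simp
        _ ≤ β / (N * (k + 1)) *
            (W (x k ω) / Real.exp 1 * (l * (c₀ * (‖x k ω‖ / (2 + ‖x k ω‖))))) := by gcongr
        _ = β / (N * (k + 1)) *
            ((W (x k ω) / Real.exp 1 * (l / (2 + ‖x k ω‖))) * (c₀ * ‖x k ω‖)) := by
            field_simp
        _ ≤ _ := by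
          have := smoothNorm_pos (x (k + j) ω)
          have : 0 < W (x (k + j) ω) := Real.exp_pos _
          gcongr
    rw [Finset.sum_sub_distrib]
    have hs1 := Finset.sum_le_sum hpos
    have hs2 := Finset.single_le_sum (fun i _ => hneg i) (Finset.mem_range.2 hj)
    have hs3 : ∑ _j ∈ Finset.range N, 2 * l ^ 2 * (Real.exp 1 * W (x k ω)) * (β * M / (k + 1)) ^ 2
        = b * (l / (k + 1)) ^ 2 * W (x k ω) := by
      rw [Finset.sum_const, Finset.card_range, nsmul_eq_mul, hb]
      ring
    have hs4 : b * (l / (k + 1)) ^ 2 ≤ a₀ / 2 * l / (k + 1) := by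
      have i1 : b * (l / (k + 1)) ≤ a₀ / 2 := by
        have : l / (k + 1) * (2 * (b + 1)) ≤ a₀ := by
          rw [← le_div_iff₀ (by positivity)]; exact hlk'.trans hc1
        have : 0 ≤ l / (k + 1) := by positivity
        nlinarith
      calc b * (l / (k + 1)) ^ 2 = b * (l / (k + 1)) * (l / (k + 1)) := by ring
        _ ≤ a₀ / 2 * (l / (k + 1)) := by gcongr
        _ = _ := by ring
    have hs5 := mul_le_mul_of_nonneg_right hs4 hW0.le
    have hs6 : a₀ * l / (k + 1) * W (x k ω) = 2 * (a₀ / 2 * l / (k + 1) * W (x k ω)) := by ring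
    rw [hs3] at hs1
    linarith
  have hinA : ∫ ω in A, W (x (k + N) ω) ∂P
      ≤ (1 - a₀ / 2 * l / (k + 1)) * ∫ ω in A, W (x k ω) ∂P := by
    have hcs := continuous_smoothNorm (n := n)
    have hstep := h.setIntegral_add_le k (W := W)
      (q := fun v => W v * (l / smoothNorm v)) (κ := fun v => 2 * l ^ 2 * W v) hW
      (hW.mul (continuous_const.div hcs fun v => (smoothNorm_pos v).ne'))
      (continuous_const.mul hW) (fun v => by positivity)
      (fun v w hw => exp_smoothNorm_add_le v w hl (by
        refine le_trans ?_ hlk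
        have i1 : (1 : ℝ) ≤ N := by exact_mod_cast h.window_pos
        have := h.gain_mul_bound_nonneg
        gcongr
        exact hw.trans (le_mul_of_one_le_left (by positivity) i1))) hA N
    refine hstep.trans ?_
    rw [← integral_const_mul]
    refine setIntegral_mono_on ?_ ((h.integrable_comp k hW).const_mul _).integrableOn hA' hpt
    refine ((h.integrable_comp k hW).add (integrable_finsetSum _ fun j _ =>
      h.integrable_comp (k + j) (G := fun v => 2 * l ^ 2 * W v * (β * M / ((k + j : ℕ) + 1)) ^ 2
      - β / ((k + j : ℕ) + 1) * ((W v * (l / smoothNorm v))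
        * recursionDrift φ g (k + j) v)) ?_)).integrableOn
    have h1 := h.continuous_drift (k + j)
    have h2 : Continuous fun v : EuclideanSpace ℝ (Fin n) => l / smoothNorm v :=
      continuous_const.div hcs fun v => (smoothNorm_pos v).ne'
    fun_prop
  have hinAc : ∫ ω in Aᶜ, W (x (k + N) ω) ∂P ≤ Real.exp 1 * Real.exp (l * √(1 + r ^ 2)) := by
    have h1 : ∫ ω in Aᶜ, W (x (k + N) ω) ∂P
        ≤ ∫ ω in Aᶜ, Real.exp 1 * Real.exp (l * √(1 + r ^ 2)) ∂P := by
      refine setIntegral_mono_on (h.integrable_comp _ hW).integrableOn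
        (integrable_const _).integrableOn hA'.compl fun ω hω => ?_
      refine (h.exp_smoothNorm_window_le hl hlk le_rfl ω).1.trans ?_
      have h2 : ‖x k ω‖ ≤ r := (not_le.1 (show ¬ r ≤ ‖x k ω‖ from hω)).le
      unfold smoothNorm
      gcongr
    refine h1.trans ?_
    rw [setIntegral_const, smul_eq_mul]
    exact mul_le_of_le_one_left (by positivity) measureReal_le_one
  have hAle : ∫ ω in A, W (x k ω) ∂P ≤ ∫ ω, W (x k ω) ∂P :=
    setIntegral_le_integral (h.integrable_comp k hW)
      (Eventually.of_forall fun ω => (Real.exp_pos _).le)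
  rw [← integral_add_compl hA' (h.integrable_comp (k + N) hW)]
  have := mul_le_mul_of_nonneg_left hAle hfac
  linarith

end StochasticRecursion

/-! ### Iterated contraction and the tail of the error -/

theorem log_add_sub_log_le {a b : ℝ} (ha : 0 < a) (hb : 0 ≤ b) :
    Real.log (a + b) - Real.log a ≤ b / a := by
  rw [← Real.log_div (by positivity) ha.ne']
  have h := Real.log_le_sub_one_of_pos (show 0 < (a + b) / a by positivity)
  have e : (a + b) / a - 1 = b / a := by field_simp; ring
  linarith

namespace StochasticRecursion

set_option linter.unusedSectionVars false

variable {n : ℕ} {Ω : Type*} [mΩ : MeasurableSpace Ω] {P : Measure Ω} [IsProbabilityMeasure P]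
  {φ : ℕ → EuclideanSpace ℝ (Fin n)} {M β δ : ℝ} {N : ℕ} {R₀ : ℝ} {g : ℕ → ℝ → ℝ}
  {ℱ : ℕ → MeasurableSpace Ω} {x : ℕ → Ω → EuclideanSpace ℝ (Fin n)} {ξ : ℕ → Ω → ℝ}

theorem integral_exp_smoothNorm_le (h : StochasticRecursion P φ M β δ N R₀ g ℱ x ξ) {l : ℝ}
    (hl : 0 ≤ l) (m : ℕ) : ∫ ω, Real.exp (l * smoothNorm (x m ω)) ∂P
      ≤ Real.exp (l * (1 + (R₀ + β * M * (1 + Real.log (m + 1))))) := by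
  have hlog : Real.log m ≤ Real.log (m + 1) := by
    rcases Nat.eq_zero_or_pos m with rfl | hm
    · simp
    · exact Real.log_le_log (by exact_mod_cast hm) (by linarith)
  have hβM := h.gain_mul_bound_nonneg
  calc ∫ ω, Real.exp (l * smoothNorm (x m ω)) ∂P
      ≤ ∫ _ω, Real.exp (l * (1 + (R₀ + β * M * (1 + Real.log (m + 1))))) ∂P := by
        refine integral_mono (h.integrable_comp m (continuous_exp_smoothNorm l))
          (integrable_const _) fun ω => ?_
        have h1 : smoothNorm (x m ω) ≤ 1 + (R₀ + β * M * (1 + Real.log (m + 1))) := by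
          refine (smoothNorm_le _).trans ?_
          gcongr
          refine (h.norm_le_log m ω).trans ?_
          gcongr
        exact Real.exp_le_exp.2 (by gcongr)
    _ = _ := by simp

/-- Since `1 - t ≤ exp (-t)` and `N / (k + 1)` dominates the increment of `log` over a window, the
product of the contraction factors telescopes into a difference of logarithms. The additive terms
are never amplified, so they sum to at most `i * E`. -/
theorem integral_exp_iterate_le (h : StochasticRecursion P φ M β δ N R₀ g ℱ x ξ) {a l E : ℝ}
    {m : ℕ} (hE : 0 ≤ E) (ha : 0 ≤ a) (hl : 0 ≤ l)
    (hcontr : ∀ k : ℕ, m ≤ k → 0 ≤ 1 - a * l / (k + 1) ∧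
      ∫ ω, Real.exp (l * smoothNorm (x (k + N) ω)) ∂P ≤
        (1 - a * l / (k + 1)) * ∫ ω, Real.exp (l * smoothNorm (x k ω)) ∂P + E) (i : ℕ) :
    ∫ ω, Real.exp (l * smoothNorm (x (m + i * N) ω)) ∂P ≤
      Real.exp (l * ((1 + (R₀ + β * M * (1 + Real.log (m + 1))))
        - a / N * (Real.log ((m + i * N : ℕ) + 1) - Real.log (m + 1)))) + i * E := by
  have hN : (0 : ℝ) < N := by exact_mod_cast h.window_pos
  induction i with
  | zero => simpa using h.integral_exp_smoothNorm_le hl m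
  | succ i ih =>
    set k := m + i * N with hk
    obtain ⟨h0, h1⟩ := hcontr k (Nat.le_add_right _ _)
    have hkN : m + (i + 1) * N = k + N := by rw [hk]; ring
    rw [hkN]
    set Z := 1 + (R₀ + β * M * (1 + Real.log (m + 1))) with hZ
    have h2 := mul_le_mul_of_nonneg_left ih h0
    have hal : 0 ≤ a * l / (k + 1) := by positivity
    have h3 : (1 - a * l / (k + 1)) * (i * E) ≤ i * E :=
      mul_le_of_le_one_left (by positivity) (by linarith)
    have h4 : (1 - a * l / (k + 1)) *
        Real.exp (l * (Z - a / N * (Real.log ((k : ℕ) + 1) - Real.log (m + 1))))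
        ≤ Real.exp (l * (Z - a / N * (Real.log ((k + N : ℕ) + 1) - Real.log (m + 1)))) := by
      have h5 : 1 - a * l / (k + 1) ≤ Real.exp (-(a * l / (k + 1))) := by
        have := Real.add_one_le_exp (-(a * l / ((k : ℝ) + 1)))
        linarith
      refine (mul_le_mul_of_nonneg_right h5 (Real.exp_pos _).le).trans ?_
      rw [← Real.exp_add, Real.exp_le_exp]
      have h6 := log_add_sub_log_le (show (0 : ℝ) < k + 1 by positivity) hN.le
      have h7 : l * (a / N) * (Real.log (k + 1 + N) - Real.log (k + 1)) ≤
          l * (a / N) * (N / (k + 1)) := by gcongr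
      have h8 : l * (a / N) * (N / (k + 1)) = a * l / (k + 1) := by field_simp
      have h9 : ((k + N : ℕ) : ℝ) + 1 = k + 1 + N := by push_cast; ring
      rw [h9]
      linarith
    push_cast at h1 h2 h3 h4 ⊢
    linarith

theorem measureReal_norm_ge_le (h : StochasticRecursion P φ M β δ N R₀ g ℱ x ξ) {l ρ : ℝ}
    (hl : 0 ≤ l) (hρ : 0 ≤ ρ) (k : ℕ) :
    P.real {ω | ρ ≤ ‖x k ω‖} ≤
      Real.exp (-(l * √(1 + ρ ^ 2))) * ∫ ω, Real.exp (l * smoothNorm (x k ω)) ∂P := by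
  have h1 := mul_meas_ge_le_integral_of_nonneg (μ := P)
    (f := fun ω => Real.exp (l * smoothNorm (x k ω)))
    (Eventually.of_forall fun ω => (Real.exp_pos _).le)
    (h.integrable_comp k (continuous_exp_smoothNorm l)) (Real.exp (l * √(1 + ρ ^ 2)))
  have h2 : P.real {ω | ρ ≤ ‖x k ω‖}
      ≤ P.real {ω | Real.exp (l * √(1 + ρ ^ 2)) ≤ Real.exp (l * smoothNorm (x k ω))} := by
    refine measureReal_mono fun ω hω => ?_
    have hω' : ρ ≤ ‖x k ω‖ := hω
    simp only [mem_ofPred_eq, smoothNorm]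
    gcongr
  rw [Real.exp_neg, ← div_eq_inv_mul, le_div_iff₀ (Real.exp_pos _), mul_comm]
  exact (mul_le_mul_of_nonneg_left h2 (Real.exp_pos _).le).trans h1

/-- The error leaves a fixed ball with a probability that is exponentially small in a power of the
time. -/
theorem exists_tail_exp (h : StochasticRecursion P φ M β δ N R₀ g ℱ x ξ) {ρ : ℝ} (hρ : 0 < ρ) :
    ∃ α b : ℝ, 0 < α ∧ 0 < b ∧ ∀ᶠ k : ℕ in atTop,
      P.real {ω | ρ ≤ ‖x k ω‖} ≤ (1 + 3 * k) * Real.exp (-b * (k : ℝ) ^ α) := by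
  -- Contracting outside radius `ρ / 2` while measuring the tail at `ρ` leaves the gap `s` below,
  -- which produces the exponential factor.
  obtain ⟨a, c, ha, hc, hev⟩ := h.exists_exp_window_contraction (half_pos hρ)
  obtain ⟨k₀, hk₀⟩ := eventually_atTop.1 hev
  have hN : (0 : ℝ) < N := by exact_mod_cast h.window_pos
  have hβM := h.gain_mul_bound_nonneg
  set a' := a / N with ha'
  have ha'pos : 0 < a' := by positivity
  -- With this choice `(β * M + a') * α = a' / 2`: the initial growth and the decay lost before time
  -- `m` use only half of `a' * log K`, and the other half absorbs the constant `Z`.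
  set α := a' / (2 * (β * M + a')) with hα
  have hαpos : 0 < α := by positivity
  have hα1 : α ≤ 1 / 2 := by
    rw [hα, div_le_div_iff₀ (by positivity) (by positivity)]; linarith
  set s := √(1 + ρ ^ 2) - √(1 + (ρ / 2) ^ 2) with hs
  have hspos : 0 < s := sub_pos.2 (Real.sqrt_lt_sqrt (by positivity) (by nlinarith))
  refine ⟨α, c * s, hαpos, by positivity, ?_⟩
  have hpow : Tendsto (fun k : ℕ => (k : ℝ) ^ α) atTop atTop :=
    (tendsto_rpow_atTop hαpos).comp tendsto_natCast_atTop_atTop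
  have hlog : Tendsto (fun k : ℕ => Real.log ((k : ℝ) + 1)) atTop atTop :=
    Real.tendsto_log_atTop.comp
      (tendsto_atTop_add_const_right _ 1 tendsto_natCast_atTop_atTop)
  set Z := 1 + (R₀ + β * M) + (β * M + a') * Real.log (N + 3) with hZ
  filter_upwards [hpow.eventually_ge_atTop (k₀ : ℝ), hpow.eventually_ge_atTop (1 / c),
    hlog.eventually_ge_atTop (2 * Z / a'), eventually_ge_atTop 1] with K h1 h2 h3 hK1
  have hK1' : (1 : ℝ) ≤ K := by exact_mod_cast hK1
  set m₀ := ⌈(K : ℝ) ^ α⌉₊ with hm₀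
  have hm₀K : m₀ ≤ K := by
    refine Nat.ceil_le.2 ?_
    calc (K : ℝ) ^ α ≤ (K : ℝ) ^ (1 : ℝ) := Real.rpow_le_rpow_of_exponent_le hK1' (by linarith)
      _ = K := Real.rpow_one _
  set I := (K - m₀) / N with hI
  -- The remainder is added so that `K - m` is an exact multiple of `N`.
  set m := m₀ + (K - m₀) % N with hm
  have hmK : m + I * N = K := by
    have := Nat.mod_add_div (K - m₀) N
    rw [hm, hI, mul_comm _ N]
    omega
  have hmlow : (K : ℝ) ^ α ≤ m :=
    (Nat.le_ceil _).trans (by exact_mod_cast (Nat.le_add_right m₀ _))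
  have hmup : (m : ℝ) + 1 ≤ ((K : ℝ) + 1) ^ α * (N + 3) := by
    have i1 : (m₀ : ℝ) < (K : ℝ) ^ α + 1 := Nat.ceil_lt_add_one (by positivity)
    have i2 : (m : ℝ) ≤ m₀ + N := by
      have := (Nat.mod_lt (K - m₀) h.window_pos).le
      exact_mod_cast (by omega : m ≤ m₀ + N)
    have i3 : (K : ℝ) ^ α ≤ ((K : ℝ) + 1) ^ α := Real.rpow_le_rpow (by positivity) (by linarith) hαpos.le
    have i4 : (1 : ℝ) ≤ ((K : ℝ) + 1) ^ α := Real.one_le_rpow (by linarith) hαpos.le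
    have i5 : ((N : ℝ) + 2) * 1 ≤ (N + 2) * ((K : ℝ) + 1) ^ α := by gcongr
    linarith
  have hmlog : Real.log (m + 1) ≤ α * Real.log (K + 1) + Real.log (N + 3) := by
    refine (Real.log_le_log (by positivity) hmup).trans ?_
    rw [Real.log_mul (by positivity) (by positivity), Real.log_rpow (by positivity)]
  -- The largest parameter admissible at the starting time, hence at all later times.
  set l := c * ((m : ℝ) + 1) with hl
  have hcm : c * (K : ℝ) ^ α ≤ l := by rw [hl]; gcongr; linarith
  have hl1 : 1 ≤ l := by
    refine le_trans ?_ hcm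
    rwa [div_le_iff₀ hc, mul_comm] at h2
  have hl0 : 0 ≤ l := by linarith
  have hmk₀ : k₀ ≤ m := by exact_mod_cast h1.trans hmlow
  have hit := h.integral_exp_iterate_le (a := a) (l := l) (m := m)
    (E := Real.exp 1 * Real.exp (l * √(1 + (ρ / 2) ^ 2))) (by positivity) ha.le hl0
    (fun k hk => hk₀ k (hmk₀.trans hk) l hl1 (by rw [hl]; gcongr)) I
  rw [hmK] at hit
  have hexp : (1 + (R₀ + β * M * (1 + Real.log (m + 1))))
        - a / N * (Real.log (K + 1) - Real.log (m + 1)) ≤ 0 := by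
    have i1 : (β * M + a') * Real.log (m + 1)
        ≤ (β * M + a') * (α * Real.log (K + 1) + Real.log (N + 3)) := by gcongr
    have i2 : (β * M + a') * (α * Real.log (K + 1)) = a' / 2 * Real.log (K + 1) := by
      rw [hα]; field_simp
    have i3 : Z ≤ a' / 2 * Real.log (K + 1) := by
      rw [div_le_iff₀ ha'pos] at h3; linarith
    rw [← ha']
    linarith
  have hIK : (I : ℝ) ≤ K := by
    exact_mod_cast (Nat.div_le_self _ _).trans (Nat.sub_le _ _)
  have hu : ∫ ω, Real.exp (l * smoothNorm (x K ω)) ∂P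
      ≤ (1 + 3 * K) * Real.exp (l * √(1 + (ρ / 2) ^ 2)) := by
    refine hit.trans ?_
    have i1 : Real.exp (l * ((1 + (R₀ + β * M * (1 + Real.log (m + 1))))
        - a / N * (Real.log (K + 1) - Real.log (m + 1))))
        ≤ Real.exp (l * √(1 + (ρ / 2) ^ 2)) :=
      Real.exp_le_exp.2 (mul_le_mul_of_nonneg_left (hexp.trans (Real.sqrt_nonneg _)) hl0)
    have i2 : (I : ℝ) * (Real.exp 1 * Real.exp (l * √(1 + (ρ / 2) ^ 2)))
        ≤ K * (3 * Real.exp (l * √(1 + (ρ / 2) ^ 2))) := by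
      have := Real.exp_one_lt_three.le
      gcongr
    linarith
  calc P.real {ω | ρ ≤ ‖x K ω‖}
      ≤ Real.exp (-(l * √(1 + ρ ^ 2))) * ∫ ω, Real.exp (l * smoothNorm (x K ω)) ∂P :=
        h.measureReal_norm_ge_le hl0 hρ.le K
    _ ≤ Real.exp (-(l * √(1 + ρ ^ 2)))
        * ((1 + 3 * K) * Real.exp (l * √(1 + (ρ / 2) ^ 2))) := by gcongr
    _ = (1 + 3 * K) * Real.exp (-(l * s)) := by
        rw [mul_left_comm, ← Real.exp_add]; congr 2; rw [hs]; ring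
    _ ≤ (1 + 3 * K) * Real.exp (-(c * s) * (K : ℝ) ^ α) := by
        gcongr
        nlinarith [mul_le_mul_of_nonneg_right hcm hspos.le]

theorem eventually_tail_le (h : StochasticRecursion P φ M β δ N R₀ g ℱ x ξ) {ρ : ℝ} (hρ : 0 < ρ)
    (p : ℕ) : ∀ᶠ k : ℕ in atTop, P.real {ω | ρ ≤ ‖x k ω‖} * (k : ℝ) ^ p ≤ 1 := by
  obtain ⟨α, b, hα, hb, hev⟩ := h.exists_tail_exp hρ
  have hpow : Tendsto (fun k : ℕ => (k : ℝ) ^ α) atTop atTop :=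
    (tendsto_rpow_atTop hα).comp tendsto_natCast_atTop_atTop
  have hlit := ((isLittleO_exp_neg_mul_rpow_atTop hb (-((p + 1) / α))).comp_tendsto hpow).bound
    (show (0 : ℝ) < 1 / 4 by norm_num)
  filter_upwards [hev, hlit, eventually_ge_atTop 1] with k h1 h2 hk
  have hk1 : (1 : ℝ) ≤ k := by exact_mod_cast hk
  have hk0 : (0 : ℝ) < k := by linarith
  simp only [Function.comp_apply, Real.norm_eq_abs, Real.abs_exp] at h2
  rw [← Real.rpow_mul hk0.le, abs_of_nonneg (by positivity),
    show α * -(((p : ℝ) + 1) / α) = -((p + 1 : ℕ) : ℝ) by push_cast; field_simp,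
    Real.rpow_neg hk0.le, Real.rpow_natCast] at h2
  calc P.real {ω | ρ ≤ ‖x k ω‖} * (k : ℝ) ^ p
      ≤ (1 + 3 * k) * (1 / 4 * ((k : ℝ) ^ (p + 1))⁻¹) * (k : ℝ) ^ p := by
        gcongr
        exact h1.trans (by gcongr)
    _ ≤ (4 * k) * (1 / 4 * ((k : ℝ) ^ (p + 1))⁻¹) * (k : ℝ) ^ p := by gcongr; linarith
    _ = 1 := by rw [pow_succ]; field_simp

end StochasticRecursion

/-! ### The quadratic-cubic Lyapunov function -/

/-- The Lyapunov function `‖v‖² + B ‖v‖³`. -/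
noncomputable def cubicLyapunov {n : ℕ} (B : ℝ) (v : EuclideanSpace ℝ (Fin n)) : ℝ :=
  ‖v‖ ^ 2 + B * ‖v‖ ^ 3

/-- With `a = ‖v + w‖` and `b = ‖v‖`, the identity `a³ = (3 * b / 2) * a² - b³ / 2 + (a - b)² * (a +
b / 2)` reduces the cube to the exact expansion of `a²` and the bound `|a - b| ≤ ‖w‖`. -/
theorem norm_add_cube_le {n : ℕ} (v w : EuclideanSpace ℝ (Fin n)) :
    ‖v + w‖ ^ 3 ≤ ‖v‖ ^ 3 + 3 * ‖v‖ * inner ℝ v w + (3 * ‖v‖ + ‖w‖) * ‖w‖ ^ 2 := by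
  have h1 : ‖v + w‖ ^ 2 = ‖v‖ ^ 2 + 2 * inner ℝ v w + ‖w‖ ^ 2 := norm_add_sq_real v w
  have h2 : ‖v + w‖ ≤ ‖v‖ + ‖w‖ := norm_add_le v w
  have h3 : ‖v‖ - ‖v + w‖ ≤ ‖w‖ := by
    have := norm_sub_norm_le v (v + w)
    rwa [sub_add_cancel_left, norm_neg] at this
  have h4 : (‖v + w‖ - ‖v‖) ^ 2 ≤ ‖w‖ ^ 2 := sq_le_sq' (by linarith) (by linarith)
  have h5 : (‖v + w‖ - ‖v‖) ^ 2 * (‖v + w‖ + ‖v‖ / 2) ≤ ‖w‖ ^ 2 * (‖v‖ + ‖w‖ + ‖v‖ / 2) := by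
    gcongr
  have h6 : (3 * ‖v‖ / 2) * ‖v + w‖ ^ 2
      = (3 * ‖v‖ / 2) * (‖v‖ ^ 2 + 2 * inner ℝ v w + ‖w‖ ^ 2) := by rw [h1]
  linear_combination h5 + h6

theorem cubicLyapunov_add_le {n : ℕ} {B s : ℝ} (hB : 0 ≤ B) (v w : EuclideanSpace ℝ (Fin n))
    (hw : ‖w‖ ≤ s) :
    cubicLyapunov B (v + w) ≤ cubicLyapunov B v + (2 + 3 * B * ‖v‖) * inner ℝ v w
      + (1 + B * (3 * ‖v‖ + s)) * ‖w‖ ^ 2 := by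
  unfold cubicLyapunov
  have h1 := mul_le_mul_of_nonneg_left (norm_add_cube_le v w) hB
  have h2 : ‖v + w‖ ^ 2 = ‖v‖ ^ 2 + 2 * inner ℝ v w + ‖w‖ ^ 2 := norm_add_sq_real v w
  have h3 : B * (‖w‖ * ‖w‖ ^ 2) ≤ B * (s * ‖w‖ ^ 2) := by gcongr
  rw [h2]
  linarith

theorem continuous_cubicLyapunov {n : ℕ} (B : ℝ) :
    Continuous (cubicLyapunov B : EuclideanSpace ℝ (Fin n) → ℝ) := by
  unfold cubicLyapunov; fun_prop

theorem cubicLyapunov_nonneg {n : ℕ} {B : ℝ} (hB : 0 ≤ B) (v : EuclideanSpace ℝ (Fin n)) :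
    0 ≤ cubicLyapunov B v := by
  unfold cubicLyapunov; positivity

/-- A Lipschitz estimate on the unit ball, used to replace each point of a window by its starting
point: `2 * (1 + B) * M²` comes from the square and `B * M²` from the weight. -/
theorem weighted_inner_sq_lower {n : ℕ} {B M : ℝ} (hB : 0 ≤ B) (hM : 0 ≤ M)
    {p v w : EuclideanSpace ℝ (Fin n)} (hp : ‖p‖ ≤ M) (hv : ‖v‖ ≤ 1) (hw : ‖w‖ ≤ 1) :
    (1 + B * ‖v‖) * (inner ℝ p v : ℝ) ^ 2 - (2 + 3 * B) * M ^ 2 * ‖w - v‖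
      ≤ (1 + B * ‖w‖) * (inner ℝ p w : ℝ) ^ 2 := by
  have hbound : ∀ z : EuclideanSpace ℝ (Fin n), |inner ℝ p z| ≤ M * ‖z‖ := fun z =>
    (abs_real_inner_le_norm p z).trans (by gcongr)
  have h1 : (inner ℝ p v : ℝ) ^ 2 - (inner ℝ p w : ℝ) ^ 2 ≤ 2 * M ^ 2 * ‖w - v‖ := by
    have e : (inner ℝ p v : ℝ) ^ 2 - (inner ℝ p w : ℝ) ^ 2
        = inner ℝ p (v - w) * (inner ℝ p v + inner ℝ p w) := by rw [inner_sub_right]; ring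
    rw [e]
    refine (le_abs_self _).trans ?_
    rw [abs_mul]
    have i1 := hbound (v - w)
    rw [norm_sub_rev] at i1
    have i2 : |inner ℝ p v + inner ℝ p w| ≤ 2 * M := by
      refine (abs_add_le _ _).trans ?_
      have j1 := (hbound v).trans (mul_le_of_le_one_right hM hv)
      have j2 := (hbound w).trans (mul_le_of_le_one_right hM hw)
      linarith
    calc |inner ℝ p (v - w)| * |inner ℝ p v + inner ℝ p w| ≤ (M * ‖w - v‖) * (2 * M) := by gcongr
      _ = _ := by ring
  have h2 : ‖v‖ - ‖w‖ ≤ ‖w - v‖ := by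
    rw [norm_sub_rev]; exact norm_sub_norm_le v w
  have h3 : (inner ℝ p w : ℝ) ^ 2 ≤ M ^ 2 := by
    rw [← sq_abs]
    exact pow_le_pow_left₀ (abs_nonneg _) ((hbound w).trans (mul_le_of_le_one_right hM hw)) 2
  have h4 : (1 + B * ‖v‖) * ((inner ℝ p v : ℝ) ^ 2 - (inner ℝ p w : ℝ) ^ 2)
      ≤ (1 + B * 1) * (2 * M ^ 2 * ‖w - v‖) := by
    refine (mul_le_mul_of_nonneg_left h1 (by positivity)).trans ?_
    gcongr
  have h5 : B * (‖v‖ - ‖w‖) * (inner ℝ p w : ℝ) ^ 2 ≤ B * ‖w - v‖ * M ^ 2 := by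
    refine (mul_le_mul_of_nonneg_right (mul_le_mul_of_nonneg_left h2 hB) (sq_nonneg _)).trans ?_
    gcongr
  linarith

/-! ### The mean-square recursion near the origin -/

namespace StochasticRecursion

set_option linter.unusedSectionVars false

variable {n : ℕ} {Ω : Type*} [mΩ : MeasurableSpace Ω] {P : Measure Ω} [IsProbabilityMeasure P]
  {φ : ℕ → EuclideanSpace ℝ (Fin n)} {M β δ : ℝ} {N : ℕ} {R₀ : ℝ} {g : ℕ → ℝ → ℝ}
  {ℱ : ℕ → MeasurableSpace Ω} {x : ℕ → Ω → EuclideanSpace ℝ (Fin n)} {ξ : ℕ → Ω → ℝ}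

/-- The gradient weight of the cubic term is `3 * B`, while the Lyapunov function itself requires
only `2 * B`. The surplus `f' * B * ‖v‖` pays for the loss `L * M * ‖v‖` of slope, so the leading
constant `2 * f'` is kept. -/
theorem exists_weighted_drift_lower (h : StochasticRecursion P φ M β δ N R₀ g ℱ x ξ)
    {f' L ρ : ℝ} (hf' : 0 < f') (hL : 0 ≤ L) (hρ : 0 < ρ)
    (hloc : ∀ k u, |u| ≤ ρ → (f' - L * |u|) * u ^ 2 ≤ u * g (k + 1) u) :
    ∃ B r : ℝ, 0 ≤ B ∧ 0 < r ∧ r ≤ 1 ∧ ∀ k v, ‖v‖ ≤ r →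
      2 * f' * ((1 + B * ‖v‖) * (inner ℝ (φ (k + 1)) v : ℝ) ^ 2)
        ≤ (2 + 3 * B * ‖v‖) * recursionDrift φ g k v := by
  have hM := h.bound_nonneg
  -- The surplus `f' * B = 4 * L * M` must cover `2 * L * M` and the product `3 * B * ‖v‖ * L * M`;
  -- the latter is at most `L * M` once `3 * B * ‖v‖ ≤ 1`.
  set B := 4 * L * M / f' with hB
  have hB0 : 0 ≤ B := by positivity
  have hBf : f' * B = 4 * (L * M) := by rw [hB]; field_simp
  set r := min (min (ρ / (M + 1)) (1 / (3 * B + 1))) 1 with hr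
  have hr1 : r ≤ ρ / (M + 1) := (min_le_left _ _).trans (min_le_left _ _)
  have hr2 : r ≤ 1 / (3 * B + 1) := (min_le_left _ _).trans (min_le_right _ _)
  refine ⟨B, r, hB0, ?_, min_le_right _ _, fun k v hv => ?_⟩
  · refine lt_min (lt_min ?_ ?_) one_pos <;> positivity
  have hu := h.abs_inner_regressor_le k v
  have huρ : |inner ℝ (φ (k + 1)) v| ≤ ρ := by
    have h1 := hv.trans hr1
    rw [le_div_iff₀ (by positivity)] at h1
    linarith [norm_nonneg v]
  have h1 := hloc k _ huρ
  have h2 : (f' - L * (M * ‖v‖)) * (inner ℝ (φ (k + 1)) v : ℝ) ^ 2 ≤ recursionDrift φ g k v := by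
    refine le_trans ?_ h1
    gcongr
  have h3 : 3 * B * ‖v‖ ≤ 1 := by
    have h1 := hv.trans hr2
    rw [le_div_iff₀ (by positivity)] at h1
    linarith [norm_nonneg v]
  have h4 : 2 * f' * (1 + B * ‖v‖) ≤ (2 + 3 * B * ‖v‖) * (f' - L * (M * ‖v‖)) := by
    have i1 : 0 ≤ L * M * ‖v‖ := by positivity
    have i2 := mul_le_mul_of_nonneg_left h3 i1
    have i3 : f' * B * ‖v‖ = 4 * (L * M) * ‖v‖ := by rw [hBf]
    linarith
  calc 2 * f' * ((1 + B * ‖v‖) * (inner ℝ (φ (k + 1)) v : ℝ) ^ 2)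
      = 2 * f' * (1 + B * ‖v‖) * (inner ℝ (φ (k + 1)) v : ℝ) ^ 2 := by ring
    _ ≤ (2 + 3 * B * ‖v‖) * (f' - L * (M * ‖v‖)) * (inner ℝ (φ (k + 1)) v : ℝ) ^ 2 := by gcongr
    _ = (2 + 3 * B * ‖v‖) * ((f' - L * (M * ‖v‖)) * (inner ℝ (φ (k + 1)) v : ℝ) ^ 2) := by ring
    _ ≤ _ := by gcongr

/-- Freezing the regressor form at `x k` lets excitation act on the whole window, and `(1 + B * ‖v‖)
* ‖v‖²` is exactly the Lyapunov function. Freezing the state, replacing the gains by `β / (k + N)`,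
and the second-order terms all cost only `O(1/k²)`. -/
theorem exists_lyapunov_window_le (h : StochasticRecursion P φ M β δ N R₀ g ℱ x ξ)
    {f' B r : ℝ} (hf' : 0 < f') (hB : 0 ≤ B) (hr : 0 < r) (hr1 : r ≤ 1)
    (hdrift : ∀ k v, ‖v‖ ≤ r → 2 * f' * ((1 + B * ‖v‖) * (inner ℝ (φ (k + 1)) v : ℝ) ^ 2)
        ≤ (2 + 3 * B * ‖v‖) * recursionDrift φ g k v) :
    ∃ c, 0 ≤ c ∧ ∀ᶠ k : ℕ in atTop, ∀ ω, ‖x k ω‖ < r / 2 →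
      cubicLyapunov B (x k ω) + ∑ j ∈ Finset.range N,
        ((1 + B * (3 * ‖x (k + j) ω‖ + β * M)) * (β * M / ((k + j : ℕ) + 1)) ^ 2
        - β / ((k + j : ℕ) + 1) * ((2 + 3 * B * ‖x (k + j) ω‖)
          * recursionDrift φ g (k + j) (x (k + j) ω)))
      ≤ (1 - 2 * β * δ * f' * N / k) * cubicLyapunov B (x k ω) + c / (k : ℝ) ^ 2 := by
  have hM := h.bound_nonneg
  have hβ := h.gain_pos
  have hδ := h.level_pos
  have hβM := h.gain_mul_bound_nonneg
  have hN : (0 : ℝ) < N := by exact_mod_cast h.window_pos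
  set c₁ : ℝ := N * ((2 + 3 * B) * M ^ 2 * (N * (β * M))) with hc₁
  set c₂ : ℝ := N * ((1 + B * (3 + β * M)) * (β * M) ^ 2) with hc₂
  refine ⟨c₂ + β * (2 * f') * c₁ + 2 * β * δ * f' * N * N * (1 + B), by positivity, ?_⟩
  have hlim : Tendsto (fun k : ℕ => N * (β * M / ((k : ℝ) + 1))) atTop (𝓝 0) := by
    have h1 := (tendsto_one_div_add_atTop_nhds_zero_nat (𝕜 := ℝ)).const_mul (N * (β * M))
    rw [mul_zero] at h1
    exact h1.congr fun k => by ring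
  filter_upwards [hlim.eventually_le_const (half_pos hr), eventually_ge_atTop 1] with k hk hk1 ω hω
  have hk0 : (0 : ℝ) < k := by exact_mod_cast hk1
  have hkk : 1 / ((k : ℝ) + 1) ≤ 1 / k := by gcongr; linarith
  have hdist : ∀ j ∈ Finset.range N, ‖x (k + j) ω - x k ω‖ ≤ N * (β * M / (k + 1)) :=
    fun j hj => h.norm_window_le k (Finset.mem_range.1 hj).le ω
  have hnorm : ∀ j ∈ Finset.range N, ‖x (k + j) ω‖ ≤ r := by
    intro j hj
    have h1 := norm_le_norm_add_norm_sub' (x (k + j) ω) (x k ω)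
    have h2 := hdist j hj
    linarith
  have hpos : ∀ j ∈ Finset.range N,
      (1 + B * (3 * ‖x (k + j) ω‖ + β * M)) * (β * M / ((k + j : ℕ) + 1)) ^ 2
      ≤ (1 + B * (3 + β * M)) * (β * M) ^ 2 / (k : ℝ) ^ 2 := by
    intro j hj
    have h1 := (hnorm j hj).trans hr1
    have h2 : (k : ℝ) ≤ (k + j : ℕ) + 1 := by push_cast; linarith [Nat.cast_nonneg (α := ℝ) j]
    rw [mul_div_assoc (1 + B * (3 + β * M)), ← div_pow]
    gcongr
    linarith
  have hneg : ∀ j ∈ Finset.range N, β / (k + N) * (2 * f' *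
      ((1 + B * ‖x k ω‖) * (inner ℝ (φ (k + j + 1)) (x k ω) : ℝ) ^ 2
        - (2 + 3 * B) * M ^ 2 * (N * (β * M) / k)))
      ≤ β / ((k + j : ℕ) + 1) * ((2 + 3 * B * ‖x (k + j) ω‖)
          * recursionDrift φ g (k + j) (x (k + j) ω)) := by
    intro j hj
    have hjN : ((j : ℝ) + 1) ≤ N := by exact_mod_cast Finset.mem_range.1 hj
    have h1 := hdrift (k + j) _ (hnorm j hj)
    have h2 := weighted_inner_sq_lower hB hM (h.norm_regressor_le (k + j))
      (v := x k ω) (w := x (k + j) ω) (by linarith) ((hnorm j hj).trans hr1)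
    have h3 : ‖x (k + j) ω - x k ω‖ ≤ N * (β * M) / k := by
      refine (hdist j hj).trans ?_
      calc N * (β * M / ((k : ℝ) + 1)) = N * (β * M) * (1 / (k + 1)) := by ring
        _ ≤ N * (β * M) * (1 / k) := by gcongr
        _ = _ := by ring
    have h4 : (2 + 3 * B) * M ^ 2 * ‖x (k + j) ω - x k ω‖
        ≤ (2 + 3 * B) * M ^ 2 * (N * (β * M) / k) := by gcongr
    have h5 : 0 ≤ (2 + 3 * B * ‖x (k + j) ω‖) * recursionDrift φ g (k + j) (x (k + j) ω) :=
      mul_nonneg (by positivity) (h.drift_nonneg _ _)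
    calc _ ≤ β / (k + N) * ((2 + 3 * B * ‖x (k + j) ω‖)
          * recursionDrift φ g (k + j) (x (k + j) ω)) := by
          refine mul_le_mul_of_nonneg_left (le_trans ?_ h1) (by positivity)
          refine mul_le_mul_of_nonneg_left ?_ (by positivity)
          linarith
      _ ≤ _ := by
          refine mul_le_mul_of_nonneg_right ?_ h5
          refine div_le_div_of_nonneg_left hβ.le (by positivity) ?_
          push_cast
          linarith
  have hs1 := Finset.sum_le_sum hpos
  have hs2 := Finset.sum_le_sum hneg
  rw [Finset.sum_const, Finset.card_range, nsmul_eq_mul] at hs1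
  rw [← Finset.mul_sum, ← Finset.mul_sum, Finset.sum_sub_distrib, ← Finset.mul_sum,
    Finset.sum_const, Finset.card_range, nsmul_eq_mul] at hs2
  set V := cubicLyapunov B (x k ω) with hV
  have hVeq : (1 + B * ‖x k ω‖) * (N * δ * ‖x k ω‖ ^ 2) = N * δ * V := by
    rw [hV, cubicLyapunov]; ring
  have hexc : N * δ * V ≤ (1 + B * ‖x k ω‖) *
      ∑ i ∈ Finset.range N, (inner ℝ (φ (k + i + 1)) (x k ω) : ℝ) ^ 2 := by
    rw [← hVeq]
    exact mul_le_mul_of_nonneg_left (h.excitation k (x k ω)) (by positivity)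
  have hV0 : 0 ≤ V := cubicLyapunov_nonneg hB _
  have hV1 : V ≤ 1 + B := by
    have i1 : ‖x k ω‖ ≤ 1 := by linarith
    have i2 := pow_le_one₀ (norm_nonneg _) i1 (n := 2)
    have i3 := pow_le_one₀ (norm_nonneg _) i1 (n := 3)
    have := mul_le_mul_of_nonneg_left i3 hB
    rw [hV, cubicLyapunov]; linarith
  have hs3 : β / (k + N) * (2 * f' * (N * δ * V - c₁ / k)) ≤
      β / (k + N) * (2 * f' * ((1 + B * ‖x k ω‖) *
      ∑ i ∈ Finset.range N, (inner ℝ (φ (k + i + 1)) (x k ω) : ℝ) ^ 2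
        - N * ((2 + 3 * B) * M ^ 2 * (N * (β * M) / k)))) := by
    have e : c₁ / k = N * ((2 + 3 * B) * M ^ 2 * (N * (β * M) / k)) := by rw [hc₁]; ring
    rw [e]
    gcongr
  have hinv1 : 1 / ((k : ℝ) + N) ≤ 1 / k := by gcongr; linarith
  have hinv2 : 1 / (k : ℝ) - N / (k : ℝ) ^ 2 ≤ 1 / (k + N) := by
    rw [div_sub_div _ _ hk0.ne' (by positivity), div_le_div_iff₀ (by positivity) (by positivity)]
    nlinarith [mul_nonneg hk0.le (sq_nonneg (N : ℝ))]
  have hs4 : 2 * β * δ * f' * N * V * (1 / (k : ℝ) - N / (k : ℝ) ^ 2)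
      ≤ 2 * β * δ * f' * N * V * (1 / (k + N)) := by gcongr
  have hs5 : β * (2 * f') * (c₁ / k) * (1 / (k + N)) ≤ β * (2 * f') * (c₁ / k) * (1 / k) := by
    gcongr
  have hs6 : 2 * β * δ * f' * N * V * (N / (k : ℝ) ^ 2)
      ≤ 2 * β * δ * f' * N * (1 + B) * (N / (k : ℝ) ^ 2) := by gcongr
  have e1 : β / (k + N) * (2 * f' * (N * δ * V - c₁ / k))
      = 2 * β * δ * f' * N * V * (1 / (k + N)) - β * (2 * f') * (c₁ / k) * (1 / (k + N)) := by
    ring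
  have e2 : (1 - 2 * β * δ * f' * N / k) * V
      + (c₂ + β * (2 * f') * c₁ + 2 * β * δ * f' * N * N * (1 + B)) / (k : ℝ) ^ 2
      = V - 2 * β * δ * f' * N * V * (1 / k) + N * ((1 + B * (3 + β * M)) * (β * M) ^ 2
        / (k : ℝ) ^ 2) + β * (2 * f') * (c₁ / k) * (1 / k)
        + 2 * β * δ * f' * N * (1 + B) * (N / (k : ℝ) ^ 2) := by
    rw [hc₂]; field_simp; ring
  rw [Finset.sum_sub_distrib, e2]
  linarith

/-- The local contraction is integrated over the event that `x k` is near the origin. On the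
complement a polynomial bound on the Lyapunov function is multiplied by a tail smaller than every
power. -/
theorem exists_integral_lyapunov_recursion (h : StochasticRecursion P φ M β δ N R₀ g ℱ x ξ)
    {f' L ρ : ℝ} (hf' : 0 < f') (hL : 0 ≤ L) (hρ : 0 < ρ)
    (hloc : ∀ k u, |u| ≤ ρ → (f' - L * |u|) * u ^ 2 ≤ u * g (k + 1) u) :
    ∃ B c : ℝ, 0 ≤ B ∧ 0 ≤ c ∧ ∀ᶠ k : ℕ in atTop,
      0 ≤ 1 - 2 * β * δ * f' * N / k ∧
      ∫ ω, cubicLyapunov B (x (k + N) ω) ∂P ≤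
        (1 - 2 * β * δ * f' * N / k) * ∫ ω, cubicLyapunov B (x k ω) ∂P + c / (k : ℝ) ^ 2 := by
  obtain ⟨B, r, hB, hr, hr1, hdrift⟩ := h.exists_weighted_drift_lower hf' hL hρ hloc
  obtain ⟨c, hc, hev⟩ := h.exists_lyapunov_window_le hf' hB hr hr1 hdrift
  have hβM := h.gain_mul_bound_nonneg
  set T := |R₀| + β * M * (2 + N) with hT
  have hT0 : 0 ≤ T := by positivity
  refine ⟨B, c + (T ^ 2 + B * T ^ 3), hB, by positivity, ?_⟩
  have hlim : Tendsto (fun k : ℕ => 2 * β * δ * f' * N / (k : ℝ)) atTop (𝓝 0) :=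
    tendsto_const_div_atTop_nhds_zero_nat _
  -- The exponent `5` is `3` for the growth of the cubic term, using the crude bound `‖x (k + N)‖ ≤
  -- T * k`, plus `2` for the target `1 / k²`.
  filter_upwards [hev, hlim.eventually_le_const one_pos, h.eventually_tail_le (half_pos hr) 5,
    eventually_ge_atTop 1] with k hk hk1 htail hk2
  have hk2' : (1 : ℝ) ≤ k := by exact_mod_cast hk2
  have hk0 : (0 : ℝ) < k := by linarith
  have hfac : 0 ≤ 1 - 2 * β * δ * f' * N / k := by linarith
  refine ⟨hfac, ?_⟩
  have hW := continuous_cubicLyapunov (n := n) B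
  set A : Set Ω := {ω | r / 2 ≤ ‖x k ω‖} with hAdef
  have hA : MeasurableSet[ℱ k] A := h.measurableSet_le_norm (r / 2) k
  have hA' : MeasurableSet A := h.filtration_le k _ hA
  have hin : ∫ ω in Aᶜ, cubicLyapunov B (x (k + N) ω) ∂P
      ≤ (1 - 2 * β * δ * f' * N / k) * ∫ ω in Aᶜ, cubicLyapunov B (x k ω) ∂P
        + c / (k : ℝ) ^ 2 := by
    have hstep := h.setIntegral_add_le k (W := cubicLyapunov B)
      (q := fun v => 2 + 3 * B * ‖v‖) (κ := fun v => 1 + B * (3 * ‖v‖ + β * M)) hW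
      (by fun_prop) (by fun_prop) (fun v => by positivity)
      (fun v w hw => cubicLyapunov_add_le hB v w (hw.trans
        (div_le_self hβM (by linarith)))) hA.compl N
    refine hstep.trans ?_
    have hint : Integrable (fun ω => (1 - 2 * β * δ * f' * N / k) * cubicLyapunov B (x k ω)) P :=
      (h.integrable_comp k hW).const_mul _
    calc _ ≤ ∫ ω in Aᶜ, ((1 - 2 * β * δ * f' * N / k) * cubicLyapunov B (x k ω)
          + c / (k : ℝ) ^ 2) ∂P := by
          refine setIntegral_mono_on ?_ (hint.add (integrable_const _)).integrableOn hA'.compl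
            fun ω hω => hk ω (not_le.1 hω)
          refine ((h.integrable_comp k hW).add (integrable_finsetSum _ fun j _ =>
            h.integrable_comp (k + j) (G := fun v => (1 + B * (3 * ‖v‖ + β * M))
              * (β * M / ((k + j : ℕ) + 1)) ^ 2
            - β / ((k + j : ℕ) + 1) * ((2 + 3 * B * ‖v‖)
              * recursionDrift φ g (k + j) v)) ?_)).integrableOn
          have h1 := h.continuous_drift (k + j)
          fun_prop
      _ = (1 - 2 * β * δ * f' * N / k) * ∫ ω in Aᶜ, cubicLyapunov B (x k ω) ∂P
          + P.real Aᶜ * (c / (k : ℝ) ^ 2) := by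
          rw [integral_add hint.integrableOn (integrable_const _), integral_const_mul,
            setIntegral_const, smul_eq_mul]
      _ ≤ _ := by
          gcongr
          exact mul_le_of_le_one_left (by positivity) measureReal_le_one
  have hout : ∫ ω in A, cubicLyapunov B (x (k + N) ω) ∂P
      ≤ (T ^ 2 + B * T ^ 3) / (k : ℝ) ^ 2 := by
    have hnorm : ∀ ω, ‖x (k + N) ω‖ ≤ T * k := by
      intro ω
      refine (h.norm_le_log (k + N) ω).trans ?_
      have h1 : Real.log ((k + N : ℕ) : ℝ) ≤ (k + N : ℕ) := Real.log_le_self (by positivity)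
      have h2 : (1 : ℝ) + Real.log ((k + N : ℕ) : ℝ) ≤ (2 + N) * k := by
        push_cast at h1 ⊢
        nlinarith [Nat.cast_nonneg (α := ℝ) N]
      have h3 : R₀ ≤ |R₀| * k :=
        (le_abs_self _).trans (le_mul_of_one_le_right (abs_nonneg _) hk2')
      have h4 := mul_le_mul_of_nonneg_left h2 hβM
      rw [hT]
      linarith
    have hle : ∀ ω, cubicLyapunov B (x (k + N) ω) ≤ (T ^ 2 + B * T ^ 3) * (k : ℝ) ^ 3 := by
      intro ω
      have h1 := hnorm ω
      calc cubicLyapunov B (x (k + N) ω) ≤ (T * k) ^ 2 + B * (T * k) ^ 3 := by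
            unfold cubicLyapunov; gcongr
        _ = T ^ 2 * (k : ℝ) ^ 2 + B * T ^ 3 * (k : ℝ) ^ 3 := by ring
        _ ≤ T ^ 2 * (k : ℝ) ^ 3 + B * T ^ 3 * (k : ℝ) ^ 3 := by
            gcongr
            norm_num
        _ = _ := by ring
    calc ∫ ω in A, cubicLyapunov B (x (k + N) ω) ∂P
        ≤ ∫ _ω in A, (T ^ 2 + B * T ^ 3) * (k : ℝ) ^ 3 ∂P :=
          setIntegral_mono (h.integrable_comp _ hW).integrableOn (integrable_const _).integrableOn
            hle
      _ = (T ^ 2 + B * T ^ 3) * (P.real A * (k : ℝ) ^ 5) / (k : ℝ) ^ 2 := by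
          rw [setIntegral_const, smul_eq_mul]; field_simp
      _ ≤ (T ^ 2 + B * T ^ 3) * 1 / (k : ℝ) ^ 2 := by gcongr
      _ = _ := by rw [mul_one]
  have hAle : ∫ ω in Aᶜ, cubicLyapunov B (x k ω) ∂P ≤ ∫ ω, cubicLyapunov B (x k ω) ∂P :=
    setIntegral_le_integral (h.integrable_comp k hW)
      (Eventually.of_forall fun ω => cubicLyapunov_nonneg hB _)
  rw [← integral_add_compl hA' (h.integrable_comp (k + N) hW), add_div]
  have := mul_le_mul_of_nonneg_left hAle hfac
  linarith

end StochasticRecursion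

/-! ### Deterministic window recursions -/

/-- Comparison principle for the recursive inequality
`e (k + N) ≤ (1 - q / k) e k + c / k²`. -/
theorem exists_le_supersolution {e G D : ℕ → ℝ} {c q : ℝ} {N k₀ : ℕ} (hN : 0 < N)
    (hG : ∀ k, k₀ ≤ k → 0 < G k)
    (hrec : ∀ k : ℕ, k₀ ≤ k → 0 ≤ 1 - q / k ∧
      e (k + N) ≤ (1 - q / k) * e k + c / (k : ℝ) ^ 2)
    (hGs : ∀ k : ℕ, k₀ ≤ k → (1 - q / k) * G k ≤ G (k + N))
    (hDs : ∀ k : ℕ, k₀ ≤ k → (1 - q / k) * D k + c / (k : ℝ) ^ 2 ≤ D (k + N)) :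
    ∃ b : ℝ, 0 ≤ b ∧ ∀ k, k₀ ≤ k → e k ≤ b * G k + D k := by
  -- Steps of length `N` require domination on `N` consecutive initial indices, a finite set on
  -- which `G` is positive.
  obtain ⟨b, hb⟩ := ((Finset.Ico k₀ (k₀ + N)).image fun k => (e k - D k) / G k).bddAbove
  refine ⟨max b 0, le_max_right _ _, fun k => ?_⟩
  induction k using Nat.strong_induction_on with
  | _ k ih =>
    intro hk
    by_cases hkN : k < k₀ + N
    · have h1 : (e k - D k) / G k ≤ b := hb (by
        simp only [Finset.coe_image, Set.mem_image, Finset.coe_Ico, Set.mem_Ico]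
        exact ⟨k, ⟨hk, hkN⟩, rfl⟩)
      rw [div_le_iff₀ (hG k hk)] at h1
      have h2 := mul_le_mul_of_nonneg_right (le_max_left b 0) (hG k hk).le
      linarith
    · obtain ⟨j, rfl⟩ : ∃ j, k = j + N := ⟨k - N, by omega⟩
      have hj : k₀ ≤ j := by omega
      obtain ⟨h0, h1⟩ := hrec j hj
      have h2 := mul_le_mul_of_nonneg_left (ih j (by omega) hj) h0
      have h3 := mul_le_mul_of_nonneg_left (hGs j hj) (le_max_right b 0)
      have h4 := hDs j hj
      linarith

theorem one_sub_mul_rpow_neg_le {p k N : ℝ} (hp : 0 ≤ p) (hk : 0 < k) (hN : 0 ≤ N) :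
    (1 - p * N / k) * k ^ (-p) ≤ (k + N) ^ (-p) := by
  rw [Real.rpow_def_of_pos hk, Real.rpow_def_of_pos (by positivity)]
  have h1 := Real.add_one_le_exp (-(p * N / k))
  have h2 := log_add_sub_log_le hk hN
  calc (1 - p * N / k) * Real.exp (Real.log k * -p)
      ≤ Real.exp (-(p * N / k)) * Real.exp (Real.log k * -p) := by gcongr; linarith
    _ = Real.exp (-(p * N / k) + Real.log k * -p) := (Real.exp_add _ _).symm
    _ ≤ _ := by
      rw [Real.exp_le_exp]
      have := mul_le_mul_of_nonneg_left h2 hp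
      rw [← mul_div_assoc] at this
      linarith

theorem exists_le_rpow_add_inv {e : ℕ → ℝ} {c p : ℝ} {N : ℕ} (hN : 0 < N) (hp : 0 ≤ p)
    (hp1 : p ≠ 1) (hc : 0 ≤ c)
    (hrec : ∀ᶠ k : ℕ in atTop, 0 ≤ 1 - p * N / k ∧
      e (k + N) ≤ (1 - p * N / k) * e k + c / (k : ℝ) ^ 2) :
    ∃ b D : ℝ, 0 ≤ b ∧ 0 < D * (p - 1) ∧
      ∀ᶠ k : ℕ in atTop, e k ≤ b * (k : ℝ) ^ (-p) + D / k := by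
  have hN' : (0 : ℝ) < N := by exact_mod_cast hN
  have hp1' : p - 1 ≠ 0 := sub_ne_zero.2 hp1
  -- `D / k` is a particular supersolution: its defect is `(D * (p - 1) * N + D * N² / (k + N)) /
  -- k²`. The extra `1` in `c + 1` absorbs the lower-order term, and `D` has the sign of `p - 1`, so
  -- it is negative and can be dropped when `p < 1`.
  set D := (c + 1) / (N * (p - 1)) with hD
  have hDp : D * (p - 1) * N = c + 1 := by rw [hD]; field_simp
  have hDp0 : 0 < D * (p - 1) := by
    by_contra! hcon
    nlinarith
  obtain ⟨k₁, hk₁⟩ := eventually_atTop.1 hrec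
  obtain ⟨k₂, hk₂⟩ := exists_nat_ge (|D| * N ^ 2)
  have hpos : ∀ k : ℕ, max (max k₁ k₂) 1 ≤ k → (0 : ℝ) < k := fun k hk => by
    exact_mod_cast (le_max_right _ _).trans hk
  obtain ⟨b, hb0, hb⟩ := exists_le_supersolution (e := e) (G := fun k => (k : ℝ) ^ (-p))
    (D := fun k => D / k) (c := c) (q := p * N) (k₀ := max (max k₁ k₂) 1) hN
    (fun k hk => Real.rpow_pos_of_pos (hpos k hk) _)
    (fun k hk => hk₁ k ((le_max_left _ _).trans ((le_max_left _ _).trans hk)))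
    (fun k hk => by
      simpa using one_sub_mul_rpow_neg_le hp (hpos k hk) hN'.le)
    (fun k hk => by
      have hk0 := hpos k hk
      have h1 : |D| * N ^ 2 ≤ k := hk₂.trans (by
        exact_mod_cast (le_max_right _ _).trans ((le_max_left _ _).trans hk))
      have h2 : -1 ≤ D * N ^ 2 / (k + N) := by
        rw [le_div_iff₀ (by positivity)]
        nlinarith [mul_le_mul_of_nonneg_right (neg_abs_le D) (sq_nonneg (N : ℝ))]
      have e1 : D / ((k + N : ℕ) : ℝ) - (1 - p * N / k) * (D / k)
          = (D * (p - 1) * N + D * N ^ 2 / (k + N)) / (k : ℝ) ^ 2 := by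
        push_cast
        field_simp
        ring
      have h3 : c / (k : ℝ) ^ 2 ≤ (D * (p - 1) * N + D * N ^ 2 / (k + N)) / (k : ℝ) ^ 2 := by
        gcongr
        linarith
      linarith)
  exact ⟨b, D, hb0, hDp0, eventually_atTop.2 ⟨_, hb⟩⟩

theorem isBigO_inv_of_window_recursion {e : ℕ → ℝ} {c p : ℝ} {N : ℕ} (hN : 0 < N) (hp : 1 < p)
    (hc : 0 ≤ c) (he : ∀ k, 0 ≤ e k)
    (hrec : ∀ᶠ k : ℕ in atTop, 0 ≤ 1 - p * N / k ∧
      e (k + N) ≤ (1 - p * N / k) * e k + c / (k : ℝ) ^ 2) :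
    e =O[atTop] fun k : ℕ => 1 / (k : ℝ) := by
  obtain ⟨b, D, hb, hD, hev⟩ := exists_le_rpow_add_inv hN (by linarith) hp.ne' hc hrec
  refine Asymptotics.IsBigO.of_bound (b + D) ?_
  filter_upwards [hev, eventually_ge_atTop 1] with k hk hk1
  have hk1' : (1 : ℝ) ≤ k := by exact_mod_cast hk1
  rw [Real.norm_of_nonneg (he k), Real.norm_of_nonneg (by positivity)]
  have h1 : (k : ℝ) ^ (-p) ≤ 1 / k := by
    rw [one_div, ← Real.rpow_neg_one]
    exact Real.rpow_le_rpow_of_exponent_le hk1' (by linarith)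
  calc e k ≤ b * (k : ℝ) ^ (-p) + D / k := hk
    _ ≤ b * (1 / k) + D / k := by gcongr
    _ = _ := by ring

theorem isBigO_rpow_of_window_recursion {e : ℕ → ℝ} {c p : ℝ} {N : ℕ} (hN : 0 < N) (hp0 : 0 ≤ p)
    (hp : p < 1) (hc : 0 ≤ c) (he : ∀ k, 0 ≤ e k)
    (hrec : ∀ᶠ k : ℕ in atTop, 0 ≤ 1 - p * N / k ∧
      e (k + N) ≤ (1 - p * N / k) * e k + c / (k : ℝ) ^ 2) :
    e =O[atTop] fun k : ℕ => 1 / (k : ℝ) ^ p := by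
  obtain ⟨b, D, hb, hD, hev⟩ := exists_le_rpow_add_inv hN hp0 hp.ne hc hrec
  have hD0 : D < 0 := by
    by_contra! hcon
    nlinarith
  refine Asymptotics.IsBigO.of_bound b ?_
  filter_upwards [hev, eventually_ge_atTop 1] with k hk hk1
  have hk0 : (0 : ℝ) < k := by exact_mod_cast hk1
  rw [Real.norm_of_nonneg (he k), Real.norm_of_nonneg (by positivity), one_div,
    ← Real.rpow_neg hk0.le]
  have := div_neg_of_neg_of_pos hD0 hk0
  linarith

/-- At the resonance `p = 1` a multiple of `1 / k` solves the homogeneous inequality and cannot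
absorb the source. The increment of `log` over a window, at least `N / (k + N)`, does so; the factor
`4` comes from `k + N ≤ 2 * k`. -/
theorem isBigO_log_of_window_recursion {e : ℕ → ℝ} {c : ℝ} {N : ℕ} (hN : 0 < N)
    (hc : 0 ≤ c) (he : ∀ k, 0 ≤ e k)
    (hrec : ∀ᶠ k : ℕ in atTop, 0 ≤ 1 - N / (k : ℝ) ∧
      e (k + N) ≤ (1 - N / (k : ℝ)) * e k + c / (k : ℝ) ^ 2) :
    e =O[atTop] fun k : ℕ => Real.log k / (k : ℝ) := by
  have hN' : (0 : ℝ) < N := by exact_mod_cast hN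
  obtain ⟨k₁, hk₁⟩ := eventually_atTop.1 hrec
  have hpos : ∀ k : ℕ, max k₁ N ≤ k → (0 : ℝ) < k := fun k hk => by
    exact_mod_cast hN.trans_le ((le_max_right _ _).trans hk)
  obtain ⟨b, hb0, hb⟩ := exists_le_supersolution (e := e) (G := fun k => 1 / (k : ℝ))
    (D := fun k => 4 * c / N * Real.log k / k) (c := c) (q := N) (k₀ := max k₁ N) hN
    (fun k hk => one_div_pos.2 (hpos k hk))
    (fun k hk => hk₁ k ((le_max_left _ _).trans hk))
    (fun k hk => by
      have hk0 := hpos k hk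
      have := one_sub_mul_rpow_neg_le zero_le_one hk0 hN'.le
      simpa [Real.rpow_neg_one] using this)
    (fun k hk => by
      have hk0 := hpos k hk
      have hkN : (N : ℝ) ≤ k := by exact_mod_cast (le_max_right _ _).trans hk
      have hk1 : (1 : ℝ) ≤ k := by exact_mod_cast hN.trans_le ((le_max_right _ _).trans hk)
      have h1 : (1 - N / (k : ℝ)) * (1 / k) ≤ 1 / (k + N) := by
        have := one_sub_mul_rpow_neg_le zero_le_one hk0 hN'.le
        simpa [Real.rpow_neg_one] using this
      have h2 : Real.log k + N / (k + N) ≤ Real.log (k + N) := by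
        have i1 := Real.one_sub_inv_le_log_of_pos (show (0 : ℝ) < (k + N) / k by positivity)
        rw [Real.log_div (by positivity) hk0.ne', inv_div] at i1
        have e1 : (1 : ℝ) - k / (k + N) = N / (k + N) := by field_simp; ring
        linarith
      have h3 : c / (k : ℝ) ^ 2 ≤ 4 * c / N * (N / (k + N)) * (1 / (k + N)) := by
        have e1 : 4 * c / N * (N / (k + N)) * (1 / (k + N)) = 4 * c / ((k : ℝ) + N) ^ 2 := by
          field_simp
        rw [e1, div_le_div_iff₀ (by positivity) (by positivity)]
        have : ((k : ℝ) + N) ^ 2 ≤ 4 * (k : ℝ) ^ 2 := by nlinarith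
        nlinarith [mul_le_mul_of_nonneg_left this hc]
      have h4 : 4 * c / N * Real.log k * ((1 - N / (k : ℝ)) * (1 / k))
          ≤ 4 * c / N * Real.log k * (1 / (k + N)) := by
        have := Real.log_nonneg hk1
        gcongr
      have h5 : 4 * c / N * (Real.log k + N / (k + N)) * (1 / (k + N))
          ≤ 4 * c / N * Real.log (k + N) * (1 / (k + N)) := by gcongr
      push_cast
      calc (1 - N / (k : ℝ)) * (4 * c / N * Real.log k / k) + c / (k : ℝ) ^ 2
          = 4 * c / N * Real.log k * ((1 - N / (k : ℝ)) * (1 / k)) + c / (k : ℝ) ^ 2 := by ring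
        _ ≤ 4 * c / N * Real.log k * (1 / (k + N))
            + 4 * c / N * (N / (k + N)) * (1 / (k + N)) := add_le_add h4 h3
        _ = 4 * c / N * (Real.log k + N / (k + N)) * (1 / (k + N)) := by ring
        _ ≤ _ := h5
        _ = _ := by ring)
  refine Asymptotics.IsBigO.of_bound (b + 4 * c / N) ?_
  have hlog : Tendsto (fun k : ℕ => Real.log (k : ℝ)) atTop atTop :=
    Real.tendsto_log_atTop.comp tendsto_natCast_atTop_atTop
  filter_upwards [eventually_ge_atTop (max k₁ N), hlog.eventually_ge_atTop 1] with k hk hk1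
  have hk0 := hpos k hk
  rw [Real.norm_of_nonneg (he k), Real.norm_of_nonneg (by positivity)]
  calc e k ≤ b * (1 / k) + 4 * c / N * Real.log k / k := hb k hk
    _ ≤ b * (Real.log k / k) + 4 * c / N * Real.log k / k := by gcongr
    _ = _ := by ring

/-! ### Consequences of the assumptions on regressors and noise -/

theorem PersistentlyExciting.sum_sq_inner_ge {n : ℕ} {φ : ℕ → EuclideanSpace ℝ (Fin n)}
    {M : ℝ} {N : ℕ} {δ : ℝ} (hφ : PersistentlyExciting φ M N δ) (k : ℕ)
    (v : EuclideanSpace ℝ (Fin n)) :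
    N * δ * ‖v‖ ^ 2 ≤ ∑ i ∈ Finset.range N, (inner ℝ (φ (k + i + 1)) v : ℝ) ^ 2 := by
  have hN : (0 : ℝ) < N := by exact_mod_cast hφ.pos_window
  have h1 := (hφ.excitation (k + 1) (by omega)).dotProduct_mulVec_nonneg v.ofLp
  have hnorm : v.ofLp ⬝ᵥ v.ofLp = ‖v‖ ^ 2 := by
    rw [EuclideanSpace.real_norm_sq_eq, dotProduct]
    exact Finset.sum_congr rfl fun i _ => (sq _).symm
  have hterm : ∀ i, v.ofLp ⬝ᵥ (Matrix.vecMulVec (φ i).ofLp (φ i).ofLp).mulVec v.ofLp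
      = (inner ℝ (φ i) v : ℝ) ^ 2 := by
    intro i
    rw [Matrix.vecMulVec_mulVec, EuclideanSpace.inner_eq_star_dotProduct, star_trivial,
      op_smul_eq_smul, dotProduct_smul, smul_eq_mul, dotProduct_comm (φ i).ofLp, sq]
  rw [star_trivial, Matrix.sub_mulVec, dotProduct_sub, Matrix.smul_mulVec, dotProduct_smul,
    Matrix.smul_mulVec, dotProduct_smul, Matrix.one_mulVec, Matrix.sum_mulVec, dotProduct_sum,
    hnorm, Finset.sum_congr rfl fun i _ => hterm i, smul_eq_mul, smul_eq_mul,
    Finset.sum_Ico_eq_sum_range, add_tsub_cancel_left] at h1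
  have h2 : ∑ i ∈ Finset.range N, (inner ℝ (φ (k + i + 1)) v : ℝ) ^ 2
      = ∑ i ∈ Finset.range N, (inner ℝ (φ (k + 1 + i)) v : ℝ) ^ 2 :=
    Finset.sum_congr rfl fun i _ => by rw [add_right_comm]
  rw [h2]
  have h3 : δ * ‖v‖ ^ 2 ≤ 1 / N * ∑ i ∈ Finset.range N, (inner ℝ (φ (k + 1 + i)) v : ℝ) ^ 2 := by
    linarith
  rw [one_div, inv_mul_eq_div, le_div_iff₀ hN] at h3
  linarith

namespace AdmissibleNoise

set_option linter.unusedSectionVars false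

variable {Ω : Type*} [mΩ : MeasurableSpace Ω] {P : Measure Ω} [IsProbabilityMeasure P]
  {d : ℕ → Ω → ℝ} {σ : ℝ} {F f : ℝ → ℝ}

/-- The real `sInf` of a set not bounded below is `0`, so the positive infimum in the assumption
also forces boundedness below. -/
theorem bddBelow_image (hd : AdmissibleNoise P d σ F f) {X : Set ℝ} (hX : IsOpen X)
    (hXb : Bornology.IsBounded X) (hXn : X.Nonempty) : BddBelow (f '' X) := by
  by_contra hcon
  have := hd.density_inf_pos X hX hXb hXn
  rw [Real.sInf_of_not_bddBelow hcon] at this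
  exact lt_irrefl _ this

theorem exists_lower_bound (hd : AdmissibleNoise P d σ F f) (C : ℝ) {z : ℝ} (hz : 0 ≤ z) :
    ∃ c, 0 < c ∧ ∀ t, |t - C| ≤ z → c ≤ f t := by
  have hne : (Ioo (C - z - 1) (C + z + 1)).Nonempty := ⟨C, by constructor <;> linarith⟩
  refine ⟨_, hd.density_inf_pos _ isOpen_Ioo (Metric.isBounded_Ioo _ _) hne, fun t ht => ?_⟩
  rw [abs_le] at ht
  exact csInf_le (hd.bddBelow_image isOpen_Ioo (Metric.isBounded_Ioo _ _) hne)
    ⟨t, ⟨by linarith, by linarith⟩, rfl⟩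

theorem density_pos (hd : AdmissibleNoise P d σ F f) (t : ℝ) : 0 < f t := by
  obtain ⟨c, hc, h⟩ := hd.exists_lower_bound t le_rfl
  exact hc.trans_le (h t (by simp))

theorem monotone (hd : AdmissibleNoise P d σ F f) : Monotone F := by
  intro a b hab
  rw [hd.distribution 1 le_rfl, hd.distribution 1 le_rfl]
  exact measureReal_mono fun ω (hω : d 1 ω ≤ a) => hω.trans hab

theorem nonneg (hd : AdmissibleNoise P d σ F f) (a : ℝ) : 0 ≤ F a := by
  rw [hd.distribution 1 le_rfl]; exact measureReal_nonneg

theorem le_one (hd : AdmissibleNoise P d σ F f) (a : ℝ) : F a ≤ 1 := by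
  rw [hd.distribution 1 le_rfl]; exact measureReal_le_one

theorem mul_sub_le (hd : AdmissibleNoise P d σ F f) {a b c : ℝ} (hab : a ≤ b)
    (hc : ∀ t ∈ Icc a b, c ≤ f t) : c * (b - a) ≤ F b - F a := by
  have hmeas := hd.measurable 1 le_rfl
  have h1 : F b - F a = P.real (d 1 ⁻¹' Ioc a b) := by
    rw [hd.distribution 1 le_rfl, hd.distribution 1 le_rfl,
      ← measureReal_sdiff (s₁ := {ω | d 1 ω ≤ b}) (s₂ := {ω | d 1 ω ≤ a})
        (fun ω (hω : d 1 ω ≤ a) => hω.trans hab) (measurableSet_le hmeas measurable_const)]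
    congr 1
    ext ω
    simp [and_comm]
  have h2 : ENNReal.ofReal (c * (b - a)) ≤ P (d 1 ⁻¹' Ioc a b) := by
    rw [← Measure.map_apply hmeas measurableSet_Ioc, hd.density 1 le_rfl,
      withDensity_apply _ measurableSet_Ioc]
    calc ENNReal.ofReal (c * (b - a)) = ENNReal.ofReal c * volume (Ioc a b) := by
          rw [Real.volume_Ioc, ENNReal.ofReal_mul' (by linarith)]
      _ = ∫⁻ _ in Ioc a b, ENNReal.ofReal c := (setLIntegral_const _ _).symm
      _ ≤ _ := setLIntegral_mono' measurableSet_Ioc fun t ht =>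
          ENNReal.ofReal_le_ofReal (hc t (Ioc_subset_Icc_self ht))
  rw [h1]
  exact (ENNReal.ofReal_le_iff_le_toReal (measure_ne_top _ _)).1 h2

theorem mul_sq_le (hd : AdmissibleNoise P d σ F f) {a u c : ℝ}
    (hc : ∀ t, |t - a| ≤ |u| → c ≤ f t) : c * u ^ 2 ≤ u * (F a - F (a - u)) := by
  rcases le_total 0 u with hu | hu
  · have h1 := hd.mul_sub_le (a := a - u) (b := a) (c := c) (by linarith) fun t ht => hc t (by
      rw [abs_of_nonneg hu, abs_le]; constructor <;> linarith [ht.1, ht.2])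
    nlinarith [mul_le_mul_of_nonneg_left h1 hu]
  · have h1 := hd.mul_sub_le (a := a) (b := a - u) (c := c) (by linarith) fun t ht => hc t (by
      rw [abs_of_nonpos hu, abs_le]; constructor <;> linarith [ht.1, ht.2])
    nlinarith [mul_le_mul_of_nonneg_left h1 (neg_nonneg.2 hu)]

/-- By monotonicity of `F`, the increment over `|u| ≥ r` is at least the increment over length `r`,
where the density is bounded below uniformly in the centre `a`. -/
theorem exists_force_lower (hd : AdmissibleNoise P d σ F f) (C : ℝ) {R r : ℝ} (hR : 0 ≤ R)
    (hr : 0 < r) : ∃ c, 0 < c ∧ ∀ a u, |a - C| ≤ R → r ≤ |u| →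
      c * |u| ≤ u * (F a - F (a - u)) := by
  obtain ⟨c, hc, hcf⟩ := hd.exists_lower_bound C (z := R + r) (by linarith)
  refine ⟨c * r, by positivity, fun a u ha hu => ?_⟩
  rw [abs_le] at ha
  rcases le_total 0 u with hu0 | hu0
  · rw [abs_of_nonneg hu0] at hu ⊢
    have h1 := hd.mul_sub_le (a := a - r) (b := a) (c := c) (by linarith) fun t ht => hcf t (by
      rw [abs_le]; constructor <;> linarith [ht.1, ht.2])
    have h2 := hd.monotone (show a - u ≤ a - r by linarith)
    rw [mul_comm]
    gcongr
    linarith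
  · rw [abs_of_nonpos hu0] at hu ⊢
    have h1 := hd.mul_sub_le (a := a) (b := a + r) (c := c) (by linarith) fun t ht => hcf t (by
      rw [abs_le]; constructor <;> linarith [ht.1, ht.2])
    have h2 := hd.monotone (show a + r ≤ a - u by linarith)
    rw [show u * (F a - F (a - u)) = (-u) * (F (a - u) - F a) by ring, mul_comm]
    gcongr
    · linarith
    · linarith

theorem lowerDensity_pos (hd : AdmissibleNoise P d σ F f) (C : ℝ) {R : ℝ} (hR : 0 ≤ R) :
    0 < lowerDensity f C R := by
  obtain ⟨c, hc, hcf⟩ := hd.exists_lower_bound C (z := R + 1) (by linarith)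
  refine hc.trans_le (ge_of_tendsto
    (tendsto_lowerDensity f (fun t => (hd.density_pos t).le) C R hR) ?_)
  filter_upwards [Ioo_mem_nhdsGT (show R < R + 1 by linarith)] with z hz
  refine le_csInf ⟨f C, C, ⟨by linarith [hz.1], by linarith [hz.1]⟩, rfl⟩ ?_
  rintro _ ⟨t, ht, rfl⟩
  exact hcf t (by rw [abs_le]; constructor <;> linarith [ht.1, ht.2, hz.2])

theorem sInf_image_Icc_le (hd : AdmissibleNoise P d σ F f) {C z t : ℝ} (ht : |t - C| ≤ z) :
    sInf (f '' Icc (C - z) (C + z)) ≤ f t := by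
  rw [abs_le] at ht
  refine csInf_le ⟨0, ?_⟩ ⟨t, ⟨by linarith, by linarith⟩, rfl⟩
  rintro _ ⟨s, _, rfl⟩
  exact (hd.density_pos s).le

theorem lowerDensity_le (hd : AdmissibleNoise P d σ F f) {C R t : ℝ} (hR : 0 ≤ R)
    (ht : |t - C| ≤ R) : lowerDensity f C R ≤ f t := by
  refine le_of_tendsto (tendsto_lowerDensity f (fun t => (hd.density_pos t).le) C R hR) ?_
  filter_upwards [self_mem_nhdsWithin] with z hz
  exact hd.sInf_image_Icc_le (ht.trans (le_of_lt hz))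

theorem exists_radius_of_lt_lowerDensity (hd : AdmissibleNoise P d σ F f) {C R f' : ℝ}
    (hR : 0 ≤ R) (hf' : f' < lowerDensity f C R) :
    ∃ ρ, 0 < ρ ∧ ∀ a u, |a - C| ≤ R → |u| ≤ ρ → f' * u ^ 2 ≤ u * (F a - F (a - u)) := by
  have h1 := (tendsto_lowerDensity f (fun t => (hd.density_pos t).le) C R hR).eventually_const_lt hf'
  obtain ⟨z, hz, hzR⟩ := (h1.and self_mem_nhdsWithin).exists
  have hzR' : R < z := hzR
  refine ⟨z - R, by linarith, fun a u ha hu => hd.mul_sq_le fun t ht => ?_⟩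
  refine hz.le.trans (hd.sInf_image_Icc_le ?_)
  have := abs_sub_le t a C
  linarith

/-- At the centre `a` itself the density is at least `lowerDensity f C R`, and at distance up to
`|u|` it drops by at most `L * |u|`. No slack is taken from the limiting bound. -/
theorem exists_lipschitz_lower (hd : AdmissibleNoise P d σ F f) (hf : LocallyLipschitz f)
    (C : ℝ) {R : ℝ} (hR : 0 ≤ R) :
    ∃ L, 0 ≤ L ∧ ∀ a u, |a - C| ≤ R → |u| ≤ 1 →
      (lowerDensity f C R - L * |u|) * u ^ 2 ≤ u * (F a - F (a - u)) := by
  obtain ⟨K, hK⟩ := (hf.locallyLipschitzOn (s := Icc (C - R - 1) (C + R + 1))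
    ).exists_lipschitzOnWith_of_compact isCompact_Icc
  refine ⟨K, K.2, fun a u ha hu => hd.mul_sq_le fun t ht => ?_⟩
  have hla := hd.lowerDensity_le hR ha
  rw [abs_le] at ha
  have ht1 := abs_le.1 (ht.trans hu)
  have h1 := hK.dist_le_mul a ⟨by linarith, by linarith⟩ t ⟨by linarith, by linarith⟩
  rw [Real.dist_eq, Real.dist_eq, abs_sub_comm a t] at h1
  have h2 : (K : ℝ) * |t - a| ≤ K * |u| := by gcongr
  linarith [le_abs_self (f a - f t)]

/-- The σ-algebra generated by the first `k` noise variables. -/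
abbrev _root_.noisePast (d : ℕ → Ω → ℝ) (k : ℕ) : MeasurableSpace Ω :=
  ⨆ i ∈ {i : ℕ | i < k}, MeasurableSpace.comap (d (i + 1)) inferInstance

theorem noisePast_le (hd : AdmissibleNoise P d σ F f) (k : ℕ) : noisePast d k ≤ mΩ :=
  iSup₂_le fun i _ => (hd.measurable (i + 1) (by omega)).comap_le

theorem _root_.noisePast_mono (d : ℕ → Ω → ℝ) : Monotone (noisePast d) := fun _ _ hab =>
  biSup_mono fun _ hi => lt_of_lt_of_le hi hab

theorem _root_.measurable_noisePast_succ (d : ℕ → Ω → ℝ) (k : ℕ) :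
    Measurable[noisePast d (k + 1)] (d (k + 1)) := by
  have h : MeasurableSpace.comap (d (k + 1)) inferInstance ≤ noisePast d (k + 1) :=
    le_iSup₂_of_le (f := fun i (_ : i ∈ {i : ℕ | i < k + 1}) =>
      MeasurableSpace.comap (d (i + 1)) inferInstance) k (Nat.lt_succ_self k) le_rfl
  exact (comap_measurable (d (k + 1))).mono h le_rfl

theorem indep_noisePast (hd : AdmissibleNoise P d σ F f) (k : ℕ) :
    Indep (noisePast d k) (MeasurableSpace.comap (d (k + 1)) inferInstance) P := by
  have h := indep_iSup_of_disjoint (fun i => (hd.measurable (i + 1) (by omega)).comap_le)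
    hd.indep.iIndep (S := {i : ℕ | i < k}) (T := {k}) (by simp)
  simpa [noisePast] using h

theorem integral_mul_comp_eq (hd : AdmissibleNoise P d σ F f) (k : ℕ) {G : Ω → ℝ}
    (hG : Measurable[noisePast d k] G) {ψ : ℝ → ℝ} (hψ : Measurable ψ) :
    ∫ ω, G ω * ψ (d (k + 1) ω) ∂P = (∫ ω, G ω ∂P) * ∫ ω, ψ (d (k + 1) ω) ∂P := by
  have hdm := hd.measurable (k + 1) (by omega)
  refine IndepFun.integral_fun_mul_eq_mul_integral ?_
    (hG.mono (hd.noisePast_le k) le_rfl).aestronglyMeasurable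
    (hψ.comp hdm).aestronglyMeasurable
  rw [IndepFun_iff_Indep]
  exact indep_of_indep_of_le_left (indep_of_indep_of_le_right (hd.indep_noisePast k)
    (by rw [← Function.comp_def, ← MeasurableSpace.comap_comp]
        exact MeasurableSpace.comap_mono hψ.comap_le)) hG.comap_le

theorem integral_indicator_le (hd : AdmissibleNoise P d σ F f) (k : ℕ) (a : ℝ) :
    ∫ ω, (Iic a).indicator (fun _ => (1 : ℝ)) (d (k + 1) ω) ∂P = F a := by
  have hdm := hd.measurable (k + 1) (by omega)
  have e : (fun ω => (Iic a).indicator (fun _ => (1 : ℝ)) (d (k + 1) ω))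
      = (d (k + 1) ⁻¹' Iic a).indicator 1 := by
    ext ω; simp [indicator]
  rw [e, integral_indicator_one (hdm measurableSet_Iic), hd.distribution (k + 1) (by omega)]
  rfl

end AdmissibleNoise

/-! ### The estimation error as a stochastic recursion -/

theorem binaryObs_eq_indicator {n : ℕ} {Ω : Type*} (φ : ℕ → EuclideanSpace ℝ (Fin n))
    (θ : EuclideanSpace ℝ (Fin n)) (d : ℕ → Ω → ℝ) (C : ℝ) (k : ℕ) (ω : Ω) :
    binaryObs φ θ d C k ω = (Iic (C - inner ℝ (φ k) θ)).indicator (fun _ => (1 : ℝ)) (d k ω) := by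
  by_cases h : inner ℝ (φ k) θ + d k ω ≤ C <;>
    simp [binaryObs, output, indicator, le_sub_iff_add_le', h]

/-- Adding and subtracting `F (C - φᵀθ)`, the mean of the binary observation, splits the innovation
into independent centred noise and a restoring force. Their difference `F (C - φᵀθ̂) - s` lies in
`[-1, 1]`, whence the bounded increments. -/
theorem stochasticRecursion_estError {n : ℕ} {Ω : Type*} [MeasurableSpace Ω] {P : Measure Ω}
    [IsProbabilityMeasure P] {φ : ℕ → EuclideanSpace ℝ (Fin n)} {M : ℝ} {N : ℕ} {δ : ℝ}
    (hφ : PersistentlyExciting φ M N δ) {d : ℕ → Ω → ℝ} {σ : ℝ} {F f : ℝ → ℝ}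
    (hd : AdmissibleNoise P d σ F f) (θ : EuclideanSpace ℝ (Fin n)) (C : ℝ) {β : ℝ} (hβ : 0 < β)
    (θ₀ : EuclideanSpace ℝ (Fin n)) :
    StochasticRecursion P φ M β δ N ‖θ₀ - θ‖
      (fun k u => F (C - inner ℝ (φ k) θ) - F (C - inner ℝ (φ k) θ - u))
      (noisePast d) (estError φ θ d F C β θ₀)
      (fun k ω => F (C - inner ℝ (φ k) θ) - binaryObs φ θ d C k ω) := by
  obtain ⟨K, hK⟩ := hd.lipschitz
  have hF : Continuous F := hK.continuous
  have hM : 0 ≤ M := (norm_nonneg _).trans (hφ.norm_le 1 le_rfl)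
  have hψ : ∀ a : ℝ, Measurable ((Iic a).indicator fun _ => (1 : ℝ)) := fun a =>
    measurable_const.indicator measurableSet_Iic
  have hrec : ∀ k ω, estError φ θ d F C β θ₀ (k + 1) ω = estError φ θ d F C β θ₀ k ω +
      (β / ((k : ℝ) + 1) * ((F (C - inner ℝ (φ (k + 1)) θ) - binaryObs φ θ d C (k + 1) ω)
        - (F (C - inner ℝ (φ (k + 1)) θ) - F (C - inner ℝ (φ (k + 1)) θ
          - inner ℝ (φ (k + 1)) (estError φ θ d F C β θ₀ k ω))))) • φ (k + 1) := by
    intro k ω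
    simp only [estError, saEstimate]
    rw [inner_sub_right, add_sub_right_comm]
    congr 2
    push_cast
    rw [sub_sub (C : ℝ), add_sub_cancel]
    ring
  have habs : ∀ k ω, |F (C - inner ℝ (φ (k + 1)) θ) - binaryObs φ θ d C (k + 1) ω| ≤ 1 := by
    intro k ω
    have h0 := hd.nonneg (C - inner ℝ (φ (k + 1)) θ)
    have h1 := hd.le_one (C - inner ℝ (φ (k + 1)) θ)
    unfold binaryObs
    split_ifs <;> rw [abs_le] <;> constructor <;> linarith
  refine
    { gain_pos := hβ
      level_pos := hφ.pos_level
      window_pos := hφ.pos_window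
      norm_regressor_le := fun k => hφ.norm_le (k + 1) (by omega)
      excitation := hφ.sum_sq_inner_ge
      filtration_le := hd.noisePast_le
      filtration_mono := noisePast_mono d
      adapted := ?_
      norm_init_le := fun ω => le_rfl
      recursion := hrec
      abs_le_one := ?_
      noise_measurable := ?_
      noise_bounded := fun k => ⟨1, habs k⟩
      noise_orthogonal := ?_
      force_continuous := fun k => by fun_prop
      force_nonneg := ?_
      force_lower := ?_ }
  · intro k
    induction k with
    | zero => exact measurable_const (a := θ₀ - θ)
    | succ k ih =>
      have ih' := ih.mono (noisePast_mono d (Nat.le_succ k)) le_rfl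
      have hdk := measurable_noisePast_succ d k
      have hs : Measurable[noisePast d (k + 1)] fun ω => binaryObs φ θ d C (k + 1) ω := by
        simp_rw [binaryObs_eq_indicator]
        exact (hψ _).comp hdk
      have hcont : Continuous fun p : EuclideanSpace ℝ (Fin n) × ℝ => p.1 +
          (β / ((k : ℝ) + 1) * ((F (C - inner ℝ (φ (k + 1)) θ) - p.2)
          - (F (C - inner ℝ (φ (k + 1)) θ) - F (C - inner ℝ (φ (k + 1)) θ
          - inner ℝ (φ (k + 1)) p.1)))) • φ (k + 1) := by fun_prop
      have e : estError φ θ d F C β θ₀ (k + 1) = (fun p : EuclideanSpace ℝ (Fin n) × ℝ => p.1 +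
          (β / ((k : ℝ) + 1) * ((F (C - inner ℝ (φ (k + 1)) θ) - p.2)
          - (F (C - inner ℝ (φ (k + 1)) θ) - F (C - inner ℝ (φ (k + 1)) θ
          - inner ℝ (φ (k + 1)) p.1)))) • φ (k + 1)) ∘
          (fun ω => (estError φ θ d F C β θ₀ k ω, binaryObs φ θ d C (k + 1) ω)) := by
        ext1 ω
        exact hrec k ω
      rw [e]
      exact hcont.measurable.comp (ih'.prodMk hs)
  · intro k ω
    set u := inner ℝ (φ (k + 1)) (estError φ θ d F C β θ₀ k ω)
    have h0 := hd.nonneg (C - inner ℝ (φ (k + 1)) θ - u)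
    have h1 := hd.le_one (C - inner ℝ (φ (k + 1)) θ - u)
    unfold binaryObs
    split_ifs <;> rw [abs_le] <;> constructor <;> linarith
  · intro k
    simp_rw [binaryObs_eq_indicator]
    exact measurable_const.sub ((hψ _).comp (hd.measurable (k + 1) (by omega)))
  · intro k G hG _
    simp_rw [binaryObs_eq_indicator]
    have h1 := hd.integral_mul_comp_eq k hG (ψ := fun t => F (C - inner ℝ (φ (k + 1)) θ)
      - (Iic (C - inner ℝ (φ (k + 1)) θ)).indicator (fun _ => (1 : ℝ)) t)
      (measurable_const.sub (hψ _))
    rw [h1, integral_sub (integrable_const _), hd.integral_indicator_le]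
    · simp
    · refine Integrable.of_bound
        ((hψ _).comp (hd.measurable (k + 1) (by omega))).aestronglyMeasurable 1
        (Eventually.of_forall fun ω => ?_)
      refine (norm_indicator_le_norm_self _ _).trans (by simp)
  · intro k u
    have := hd.mul_sq_le (a := C - inner ℝ (φ (k + 1)) θ) (u := u) (c := 0)
      fun t _ => (hd.density_pos t).le
    simpa using this
  · intro r hr
    obtain ⟨c, hc, h⟩ := hd.exists_force_lower C (R := M * ‖θ‖) (by positivity) hr
    refine ⟨c, hc, fun k u hu => h _ u ?_ hu⟩
    rw [sub_sub_cancel_left, abs_neg]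
    refine (abs_real_inner_le_norm _ _).trans ?_
    gcongr
    exact hφ.norm_le (k + 1) (by omega)

/-! ### Mean-square convergence rates -/

/-- Mean-square rates under a quadratic lower bound of the restoring force near the origin. -/
theorem StochasticRecursion.isBigO_integral_norm_sq {n : ℕ} {Ω : Type*} [MeasurableSpace Ω]
    {P : Measure Ω} [IsProbabilityMeasure P]
    {φ : ℕ → EuclideanSpace ℝ (Fin n)} {M β δ : ℝ} {N : ℕ} {R₀ : ℝ} {g : ℕ → ℝ → ℝ}
    {ℱ : ℕ → MeasurableSpace Ω} {x : ℕ → Ω → EuclideanSpace ℝ (Fin n)} {ξ : ℕ → Ω → ℝ}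
    (h : StochasticRecursion P φ M β δ N R₀ g ℱ x ξ) {f' L ρ p : ℝ} (hf' : 0 < f') (hL : 0 ≤ L)
    (hρ : 0 < ρ) (hloc : ∀ k u, |u| ≤ ρ → (f' - L * |u|) * u ^ 2 ≤ u * g (k + 1) u)
    (hp : p = 2 * β * δ * f') :
    (1 < p → (fun k : ℕ => ∫ ω, ‖x k ω‖ ^ 2 ∂P) =O[atTop] fun k : ℕ => 1 / (k : ℝ)) ∧
    (p = 1 → (fun k : ℕ => ∫ ω, ‖x k ω‖ ^ 2 ∂P) =O[atTop] fun k : ℕ => Real.log k / (k : ℝ)) ∧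
    (p < 1 → (fun k : ℕ => ∫ ω, ‖x k ω‖ ^ 2 ∂P) =O[atTop] fun k : ℕ => 1 / (k : ℝ) ^ p) := by
  obtain ⟨B, c, hB, hc, hrec⟩ := h.exists_integral_lyapunov_recursion hf' hL hρ hloc
  rw [← hp] at hrec
  have hp0 : 0 < p := by
    have := h.gain_pos
    have := h.level_pos
    rw [hp]; positivity
  have he : ∀ k, 0 ≤ ∫ ω, cubicLyapunov B (x k ω) ∂P := fun k =>
    integral_nonneg fun ω => cubicLyapunov_nonneg hB _
  have hle : (fun k : ℕ => ∫ ω, ‖x k ω‖ ^ 2 ∂P)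
      =O[atTop] fun k : ℕ => ∫ ω, cubicLyapunov B (x k ω) ∂P := by
    refine Asymptotics.IsBigO.of_bound 1 (Eventually.of_forall fun k => ?_)
    rw [Real.norm_of_nonneg (he k), Real.norm_of_nonneg (integral_nonneg fun ω => by positivity),
      one_mul]
    refine integral_mono (h.integrable_comp k (G := fun v => ‖v‖ ^ 2) (by fun_prop))
      (h.integrable_comp k (continuous_cubicLyapunov B)) fun ω => ?_
    exact le_add_of_nonneg_right (by positivity)
  refine ⟨fun h1 => hle.trans ?_, fun h1 => hle.trans ?_, fun h1 => hle.trans ?_⟩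
  · exact isBigO_inv_of_window_recursion h.window_pos h1 hc he hrec
  · rw [h1] at hrec
    simp only [one_mul] at hrec
    exact isBigO_log_of_window_recursion h.window_pos hc he hrec
  · exact isBigO_rpow_of_window_recursion h.window_pos hp0.le h1 hc he hrec

theorem theorem6 {n : ℕ} {Ω : Type*} [MeasurableSpace Ω] (P : Measure Ω) [IsProbabilityMeasure P]
    (φ : ℕ → EuclideanSpace ℝ (Fin n)) (M : ℝ) (N : ℕ) (δ : ℝ)
    (hφ : PersistentlyExciting φ M N δ)
    (d : ℕ → Ω → ℝ) (σ : ℝ) (F f : ℝ → ℝ)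
    (hd : AdmissibleNoise P d σ F f)
    (θ : EuclideanSpace ℝ (Fin n)) (C : ℝ)
    (β : ℝ) (hβ : 0 < β) (θ₀ : EuclideanSpace ℝ (Fin n))
    (η : ℝ) (hη : η = β * δ * lowerDensity f C (M * ‖θ‖)) :
    (∀ k : ℕ, Integrable (fun ω => ‖estError φ θ d F C β θ₀ k ω‖ ^ 2) P) ∧
    (∀ ε : ℝ, 0 < ε →
      (1 / 2 < η →
        (fun k : ℕ => ∫ ω, ‖estError φ θ d F C β θ₀ k ω‖ ^ 2 ∂P)
          =O[atTop] (fun k : ℕ => 1 / (k : ℝ))) ∧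
      (η ≤ 1 / 2 →
        (fun k : ℕ => ∫ ω, ‖estError φ θ d F C β θ₀ k ω‖ ^ 2 ∂P)
          =O[atTop] (fun k : ℕ => 1 / (k : ℝ) ^ (2 * η - ε)))) ∧
    (LocallyLipschitz f →
      (1 / 2 < η →
        (fun k : ℕ => ∫ ω, ‖estError φ θ d F C β θ₀ k ω‖ ^ 2 ∂P)
          =O[atTop] (fun k : ℕ => 1 / (k : ℝ))) ∧
      (η = 1 / 2 →
        (fun k : ℕ => ∫ ω, ‖estError φ θ d F C β θ₀ k ω‖ ^ 2 ∂P)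
          =O[atTop] (fun k : ℕ => Real.log (k : ℝ) / (k : ℝ))) ∧
      (η < 1 / 2 →
        (fun k : ℕ => ∫ ω, ‖estError φ θ d F C β θ₀ k ω‖ ^ 2 ∂P)
          =O[atTop] (fun k : ℕ => 1 / (k : ℝ) ^ (2 * η)))) := by

  have h := stochasticRecursion_estError hφ hd θ C hβ θ₀
  have hδ := hφ.pos_level
  have hβδ : 0 < β * δ := mul_pos hβ hδ
  have hR : 0 ≤ M * ‖θ‖ := mul_nonneg h.bound_nonneg (norm_nonneg θ)
  have hlow := hd.lowerDensity_pos C hR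
  have hη0 : 0 < η := by rw [hη]; positivity
  have hcenter : ∀ k, |C - inner ℝ (φ (k + 1)) θ - C| ≤ M * ‖θ‖ := by
    intro k
    rw [sub_sub_cancel_left, abs_neg]
    exact h.abs_inner_regressor_le k θ
  -- Any exponent below `η` leaves a margin in the density bound, which then holds on a fixed
  -- neighbourhood with no linear loss (`L = 0`) and no Lipschitz assumption on `f`.
  have hslack : ∀ η', 0 < η' → η' < η →
      (1 / 2 < η' → (fun k : ℕ => ∫ ω, ‖estError φ θ d F C β θ₀ k ω‖ ^ 2 ∂P)
          =O[atTop] (fun k : ℕ => 1 / (k : ℝ))) ∧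
      (η' < 1 / 2 → (fun k : ℕ => ∫ ω, ‖estError φ θ d F C β θ₀ k ω‖ ^ 2 ∂P)
          =O[atTop] (fun k : ℕ => 1 / (k : ℝ) ^ (2 * η'))) := by
    intro η' hη'0 hη'
    have hf' : η' / (β * δ) < lowerDensity f C (M * ‖θ‖) := by
      rw [div_lt_iff₀ hβδ]; linarith
    obtain ⟨ρ, hρ, hloc⟩ := hd.exists_radius_of_lt_lowerDensity hR hf'
    have key := h.isBigO_integral_norm_sq (p := 2 * η') (f' := η' / (β * δ)) (L := 0) (by positivity) le_rfl hρ
      (fun k u hu => by simpa using hloc _ u (hcenter k) hu) (by field_simp)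
    exact ⟨fun hh => key.1 (by linarith), fun hh => key.2.2 (by linarith)⟩
  have hfast : 1 / 2 < η → (fun k : ℕ => ∫ ω, ‖estError φ θ d F C β θ₀ k ω‖ ^ 2 ∂P)
      =O[atTop] (fun k : ℕ => 1 / (k : ℝ)) := fun hh =>
    -- The midpoint of `1 / 2` and `η` is still above the threshold, so the slack costs nothing in
    -- this regime.
    (hslack ((1 / 2 + η) / 2) (by linarith) (by linarith)).1 (by linarith)
  refine ⟨fun k => h.integrable_comp k (G := fun v => ‖v‖ ^ 2) (by fun_prop),
    fun ε hε => ⟨hfast, fun hh => ?_⟩, fun hlip => ⟨hfast, ?_⟩⟩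
  -- The entry `η / 2` keeps `η'` positive when `ε` is large.
  · set η' := max (η - ε / 2) (η / 2) with hη'
    have h1 : η' < η := max_lt (by linarith) (by linarith)
    have h2 : 0 < η' := lt_max_of_lt_right (by linarith)
    refine ((hslack η' h2 h1).2 (by linarith)).trans ?_
    refine Asymptotics.IsBigO.of_bound 1 ?_
    filter_upwards [eventually_ge_atTop 1] with k hk
    have hk1 : (1 : ℝ) ≤ k := by exact_mod_cast hk
    rw [Real.norm_of_nonneg (by positivity), Real.norm_of_nonneg (by positivity), one_mul]
    gcongr
    linarith [le_max_left (η - ε / 2) (η / 2)]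
  · obtain ⟨L, hL, hloc⟩ := hd.exists_lipschitz_lower hlip C hR
    have key := h.isBigO_integral_norm_sq (p := 2 * η) hlow hL one_pos
      (fun k u hu => hloc _ u (hcenter k) hu) (by rw [hη]; ring)
    exact ⟨fun hh => key.2.1 (by linarith), fun hh => key.2.2 (by linarith)⟩
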